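/- Let $(q_n)_{n\ge 0}$ and $(a_{n,i})_{n\ge 0,\,0\le i<q_n}$ be nonnegative integers with $q_n\ge 2$ for all $n$. Define words over $\{0,1\}$ by $w_0=0$ and $$w_{n+1}=w_n1^{a_{n,0}}w_n1^{a_{n,1}}\cdots w_n1^{a_{n,q_n-1}}w_n ,$$ and let $X_{\mathcal W}\subseteq\{0,1\}^{\mathbb Z}$ be the set of two-sided sequences all of whose factors are factors of some $w_n$, with the shift $S$. Assume that the subshift $(X_{\mathcal W},S)$ is minimal and aperiodic (then the $a_{n,i}$ are bounded), and let $\mu$ be its unique $S$-invariant Borel probability measure. Put $\mathcal A_0=\{0,1\}$ and $\mathcal A_n=\{a_{N,i}: N\ge n-1,\ 0\le i<q_N\}$ for $n\ge 1$; these finite sets are equal to one set $\mathcal A_{\mathcal W}$ for all large $n$. Let $\boldsymbol\tau_{\mathcal W}=(\tau_n:\mathcal A_{n+1}^*\to\mathcal A_n^*)_{n\ge 0}$ be the sequence of morphisms $$\tau_0(a)=01^a,\qquad \tau_n(a)=a_{n-1,1}a_{n-1,2}\cdots a_{n-1,q_{n-1}-1}\,a\,a_{n-1,0}\quad(n\ge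 1),$$ and let $\tau_{[n,N)}=\tau_n\circ\cdots\circ\tau_{N-1}$. Let $X^{(n)}$ be the set of $x\in\mathcal A_n^{\mathbb Z}$ all of whose factors occur in some $\tau_{[n,N)}(a)$ with $N>n$, $a\in\mathcal A_N$. For $a\in\mathcal A_n$ let $$\mathcal T_n(a)=\bigcup_{0\le k<|\tau_{[0,n)}(a)|}S^k\,\tau_{[0,n)}\bigl(\{x\in X^{(n)}:x_0=a\}\bigr)$$ be the tower of level $n$ indexed by $a$. The sequence $\boldsymbol\tau_{\mathcal W}$ is said to be of exact finite rank if there are $n_0$ and $c>0$ such that $\mathcal A_n=\mathcal A_{\mathcal W}$ for all $n\ge n_0$ and $\mu(\mathcal T_n(a))\ge c$ for all $n\ge n_0$ and $a\in\mathcal A_{\mathcal W}$. For $n\ge 1$ let $f_n(a)=\#\{0\le i<q_{n-1}:a_{n-1,i}=a\}$, and let $Q_{m,n}=\prod_{j=m}^{n-1}(q_j+1)$ for $0\le m<n$. **Proposition.** For every $a\in\mathcal A_{\mathcal W}$, $$\liminf_{m\to\infty}\mu(\mathcal T_m(a))>0\quad\Longleftrightarrow\quad\liminf_{m\to\infty}\sum_{k=m}^{\infty}\frac{f_k(a)}{Q_{m-1,k}}>0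 .$$ In particular, $\boldsymbol\tau_{\mathcal W}$ is of exact finite rank if and only if the right-hand condition holds for every $a\in\mathcal A_{\mathcal W}$. -/

import Mathlib

open Filter MeasureTheory
open scoped ENNReal

/-! ### Two-sided sequences and subshifts -/

namespace Symbolic

variable {α : Type*}

/-- The translate `S ^ n x` of a two-sided sequence. -/
def translate (n : ℤ) (x : ℤ → α) : ℤ → α := fun i => x (i + n)

/-- The shift map `S`. -/
def shift (x : ℤ → α) : ℤ → α := fun i => x (i + 1)

/-- The word `x_n x_{n+1} … x_{n+ℓ-1}` of length `ℓ`. -/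
def window (x : ℤ → α) (n : ℤ) (ℓ : ℕ) : List α :=
  (List.range ℓ).map fun i => x (n + (i : ℤ))

/-- The set of all words that occur in `x`. -/
def language (x : ℤ → α) : Set (List α) := {w | ∃ n ℓ, w = window x n ℓ}

/-- Every orbit of the shift in `X` is dense in `X`. -/
def IsMinimal [TopologicalSpace α] (X : Set (ℤ → α)) : Prop :=
  ∀ x ∈ X, X ⊆ closure (Set.range fun n : ℤ => translate n x)

/-- No point of `X` is periodic for the shift. -/
def IsAperiodic (X : Set (ℤ → α)) : Prop :=
  ∀ x ∈ X, ∀ p : ℕ, 0 < p → translate (p : ℤ) x ≠ x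

/-- The action of a nonerasing morphism, given by the images of the letters, on a two-sided
sequence: the images of the letters `x_0, x_1, …` are concatenated from coordinate `0` to the
right, and the images of `x_{-1}, x_{-2}, …` from coordinate `-1` to the left. As the morphism is
nonerasing, `i + 1` letters suffice to determine the coordinates `i` and `-(i + 1)`, so that the
default value is never used. -/
def extend [Inhabited α] (σ : α → List α) (x : ℤ → α) : ℤ → α
  | Int.ofNat i => ((window x 0 (i + 1)).flatMap σ).getD i default
  | Int.negSucc i => ((window x (-((i : ℤ) + 1)) (i + 1)).flatMap σ).reverse.getD i default

end Symbolic

/-! ### Directive sequences and their towers -/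

/-- A sequence of nonerasing morphisms `τ_n : A_{n+1}^* → A_n^*`; the alphabets `A_n` are subsets
of a common type of letters, and `τ_n` is given by the images of the letters. (The alphabets are
meant to be finite; none of the notions below depends on it.) -/
structure DirectiveSequence (α : Type*) where
  /-- the alphabet `A_n` -/
  alphabet : ℕ → Set α
  /-- the word `τ_n(a)` -/
  map : ℕ → α → List α
  map_mem : ∀ n, ∀ a ∈ alphabet (n + 1), ∀ b ∈ map n a, b ∈ alphabet n
  map_ne_nil : ∀ n, ∀ a ∈ alphabet (n + 1), map n a ≠ []

namespace DirectiveSequence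

variable {α : Type*} (τ : DirectiveSequence α)

/-- `τ.comp n k a` is the word `τ_{[n, n+k)}(a)`, where
`τ_{[n, n+k)} = τ_n ∘ τ_{n+1} ∘ ⋯ ∘ τ_{n+k-1}`, for a letter `a` of `A_{n+k}`. -/
def comp (n : ℕ) : ℕ → α → List α
  | 0, a => [a]
  | k + 1, a => (τ.map (n + k) a).flatMap (comp n k)

/-- The language of level `n`: the words that occur in `τ_{[n, N)}(a)` for some `N > n` and some
letter `a` of `A_N`. -/
def levelLanguage (n : ℕ) : Set (List α) :=
  {w | ∃ k, 0 < k ∧ ∃ a ∈ τ.alphabet (n + k), w <:+: τ.comp n k a}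

/-- The subshift of level `n`. -/
def levelSubshift (n : ℕ) : Set (ℤ → α) :=
  {x | (∀ i, x i ∈ τ.alphabet n) ∧ Symbolic.language x ⊆ τ.levelLanguage n}

/-- The height `h_n(a) = |τ_{[0, n)}(a)|`. -/
def height (n : ℕ) (a : α) : ℕ := (τ.comp 0 n a).length

/-- The base `B_n(a) = τ_{[0, n)}([a])`, where `[a]` is the set of the points `x` of the subshift
of level `n` with `x_0 = a`. -/
def base [Inhabited α] (n : ℕ) (a : α) : Set (ℤ → α) :=
  Symbolic.extend (τ.comp 0 n) '' {x | x ∈ τ.levelSubshift n ∧ x 0 = a}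

/-- The tower `T_n(a)`, the union of the sets `S ^ k B_n(a)` over `0 ≤ k < h_n(a)`. -/
def tower [Inhabited α] (n : ℕ) (a : α) : Set (ℤ → α) :=
  ⋃ k : ℕ, ⋃ _ : k < τ.height n a, Symbolic.translate (k : ℤ) '' τ.base n a

/-- The letters that belong to `A_n` for all large `n`. If the sequence of alphabets is eventually
constant, then this is its eventual value, see `eventualAlphabet_eq`. -/
def eventualAlphabet : Set α := {a | ∀ᶠ n in atTop, a ∈ τ.alphabet n}

theorem eventualAlphabet_eq {n₀ : ℕ} (h : ∀ n, n₀ ≤ n → τ.alphabet n = τ.alphabet n₀) :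
    τ.eventualAlphabet = τ.alphabet n₀ := by
  ext a
  constructor
  · intro ha
    obtain ⟨n, hn, hge⟩ := (Filter.Eventually.and ha (eventually_ge_atTop n₀)).exists
    exact h n hge ▸ hn
  · intro ha
    filter_upwards [eventually_ge_atTop n₀] with n hn
    rw [h n hn]
    exact ha

/-- `τ` is clean with respect to `μ`, with `B` as the set of the letters whose towers keep a
measure bounded away from zero: the alphabets are eventually constant, from a level `n₀` on the
towers of the letters of `B` have measure at least a constant `c > 0`, and the measures of the
towers of the other letters tend to zero. -/
def IsCleanWith [Inhabited α] [MeasurableSpace α] (μ : Measure (ℤ → α)) (B : Set α) : Prop :=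
  ∃ n₀ : ℕ, (∀ n, n₀ ≤ n → τ.alphabet n = τ.alphabet n₀) ∧ B ⊆ τ.alphabet n₀ ∧
    (∃ c : ℝ≥0∞, 0 < c ∧ ∀ n, n₀ ≤ n → ∀ a ∈ B, c ≤ μ (τ.tower n a)) ∧
    ∀ a ∈ τ.alphabet n₀ \ B, Tendsto (fun n => μ (τ.tower n a)) atTop (nhds 0)

/-- Exact finite rank: `τ` is clean, and the towers of all letters keep a measure bounded away
from zero. -/
def ExactFiniteRank [Inhabited α] [MeasurableSpace α] (μ : Measure (ℤ → α)) : Prop :=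
  τ.IsCleanWith μ τ.eventualAlphabet

end DirectiveSequence

/-! ### Ferenczi subshifts -/

/-- Cutting parameters `q_n` and spacer parameters `a_{n,i}` (`i < q_n`; the other values of
`spacer` play no role) of a standard sequence of generating words. -/
structure FerencziParameters where
  q : ℕ → ℕ
  spacer : ℕ → ℕ → ℕ
  standard : ∀ n, 2 ≤ q n

namespace FerencziParameters

variable (W : FerencziParameters)

/-- The generating words `w_0 = 0` and
`w_{n+1} = w_n 1^{a_{n,0}} w_n 1^{a_{n,1}} … w_n 1^{a_{n,q_n-1}} w_n`. -/
def word : ℕ → List ℕ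
  | 0 => [0]
  | n + 1 =>
    ((List.range (W.q n)).flatMap fun i => word n ++ List.replicate (W.spacer n i) 1) ++ word n

/-- The Ferenczi subshift: the two-sided sequences all of whose factors are factors of generating
words. The generating words only contain the letters `0` and `1`, and so do these sequences. -/
def subshift : Set (ℤ → ℕ) :=
  {x | ∀ u ∈ Symbolic.language x, ∃ n, u <:+: W.word n}

/-- The alphabets `A_0 = {0, 1}` and `A_{n+1} = {a_{N,i} : N ≥ n, 0 ≤ i < q_N}`. -/
def alphabet : ℕ → Set ℕ
  | 0 => {0, 1}
  | n + 1 => {a | ∃ N, n ≤ N ∧ ∃ i < W.q N, a = W.spacer N i}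

/-- The morphisms `τ_0(b) = 0 1^b` and
`τ_{n+1}(b) = a_{n,1} a_{n,2} … a_{n,q_n-1} b a_{n,0}`. -/
def morphism : ℕ → ℕ → List ℕ
  | 0, b => 0 :: List.replicate b 1
  | n + 1, b => ((List.range (W.q n - 1)).map fun i => W.spacer n (i + 1)) ++ [b, W.spacer n 0]

/-- The directive sequence `τ_W`. -/
def directive : DirectiveSequence ℕ where
  alphabet := W.alphabet
  map := W.morphism
  map_mem := by
    rintro (_ | n) a ha b hb
    · simp only [morphism, List.mem_cons, List.mem_replicate] at hb
      simp only [alphabet, Set.mem_insert_iff, Set.mem_singleton_iff]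
      tauto
    · have h2 := W.standard n
      simp only [morphism, List.mem_append, List.mem_map, List.mem_range, List.mem_cons,
        List.not_mem_nil, or_false] at hb
      rcases hb with ⟨i, hi, rfl⟩ | rfl | rfl
      · exact ⟨n, le_rfl, i + 1, by omega, rfl⟩
      · obtain ⟨N, hN, i, hi, rfl⟩ := ha
        exact ⟨N, by omega, i, hi, rfl⟩
      · exact ⟨n, le_rfl, 0, by omega, rfl⟩
  map_ne_nil := by
    rintro (_ | n) a _ <;> simp [morphism]

/-- `f_n(a) = #{0 ≤ i < q_{n-1} : a_{n-1,i} = a}` for `n ≥ 1` (the value for `n = 0` plays no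
role). -/
def f : ℕ → ℕ → ℕ
  | 0, _ => 0
  | n + 1, a => ((Finset.range (W.q n)).filter fun i => W.spacer n i = a).card

/-- `Q_{m,n} = (q_m + 1) (q_{m+1} + 1) ⋯ (q_{n-1} + 1)`. -/
def Q (m n : ℕ) : ℕ := ∏ j ∈ Finset.Ico m n, (W.q j + 1)

/-- The sum over `k ≥ m` of `f_k(a) / Q_{m-1,k}`, for `m ≥ 1`, as a series of nonnegative terms
with values in `[0, ∞]`; the index is `k = m + j`. -/
noncomputable def frequencySum (m : ℕ) (a : ℕ) : ℝ≥0∞ :=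
  ∑' j : ℕ, (W.f (m + j) a : ℝ≥0∞) / (W.Q (m - 1) (m + j) : ℝ≥0∞)

end FerencziParameters

/-! Write `B_m(a)` for the base of the tower, `E_m` for the total mass of the bases of level `m`,
and `M` for a bound on the spacers. For `m ≥ 1` the word `τ_m(b)` consists of all the spacers
`a_{m-1,i}` and one additional letter `b`, so it contains `a` exactly `f_m(a) + [a = b]` times.
Counting the visits to `B_m(a)` along the towers of level `m + 1` gives `μ(B_m(a)) = f_m(a) E_{m+1}
+ μ(B_{m+1}(a))`, and summing over `a` gives `E_m = (q_{m-1} + 1) E_{m+1}`. Iteration, with a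
remainder of at most `E_{m+N} ≤ 2^{-N} E_m`, yields the exact formula `μ(B_m(a)) = E_m ∑_{k ≥ m}
f_k(a) / Q_{m-1,k}` (`measure_base_eq_baseMass_mul`).

The heights of level `m` are `H + b` with `H ≥ 1` and `b ≤ M`. As the towers partition the subshift,
`H E_m ≤ 1 ≤ (M + 1) H E_m`. Hence `μ(T_m(a)) = (H + a) μ(B_m(a))` and the frequency sum agree up to
a factor `M + 1` (`measure_tower_le_and_le`), and both lower limits are positive together. Exact
finite rank follows because the eventual alphabet is finite.

The measure identities need the towers to be genuine partitions. Covering is desubstitution, proved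
by compactness (`exists_desubstitution`). Disjointness is recognizability, derived from aperiodicity
(`recognizableOn_map`). Aperiodicity also bounds the spacers. -/

namespace Symbolic

/-! ### Windows, cutting positions and images of two-sided sequences. -/

variable {α β : Type*}

theorem window_eq_map_range (x : ℤ → α) (n : ℤ) (ℓ : ℕ) :
    window x n ℓ = (List.range ℓ).map fun i : ℕ => x (n + i) := by
  simp only [window, List.bind_eq_flatMap, List.pure_def, ← List.map_eq_flatMap, List.map_map]
  rfl

@[simp]
theorem length_window (x : ℤ → α) (n : ℤ) (ℓ : ℕ) : (window x n ℓ).length = ℓ := by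
  simp [window_eq_map_range]

@[simp]
theorem getElem_window (x : ℤ → α) (n : ℤ) (ℓ i : ℕ) (h : i < (window x n ℓ).length) :
    (window x n ℓ)[i] = x (n + i) := by
  simp [window_eq_map_range]

@[simp]
theorem window_zero (x : ℤ → α) (n : ℤ) : window x n 0 = [] := rfl

theorem window_one (x : ℤ → α) (n : ℤ) : window x n 1 = [x n] := by
  simp [window_eq_map_range]

theorem window_add (x : ℤ → α) (n : ℤ) (k ℓ : ℕ) :
    window x n (k + ℓ) = window x n k ++ window x (n + k) ℓ := by
  simp [window_eq_map_range, List.range_add, add_assoc]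

theorem window_translate (x : ℤ → α) (j n : ℤ) (ℓ : ℕ) :
    window (translate j x) n ℓ = window x (n + j) ℓ := by
  simp [window_eq_map_range, translate, add_right_comm]

theorem window_eq_iff (x : ℤ → α) (n : ℤ) (w : List α) (ℓ : ℕ) :
    window x n ℓ = w ↔ w.length = ℓ ∧ ∀ i (h : i < w.length), x (n + i) = w[i] := by
  constructor
  · rintro rfl
    simp
  · rintro ⟨rfl, h⟩
    refine List.ext_getElem (by simp) fun i h₁ h₂ => ?_
    simp [h i h₂]

theorem window_infix_window (x : ℤ → α) {n n' : ℤ} {ℓ ℓ' : ℕ} (h : n' ≤ n)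
    (h' : n + ℓ ≤ n' + ℓ') : window x n ℓ <:+: window x n' ℓ' := by
  obtain ⟨d, rfl⟩ := Int.exists_add_of_le h
  obtain ⟨e, rfl⟩ : ∃ e, ℓ' = d + ℓ + e := ⟨ℓ' - (d + ℓ), by omega⟩
  exact ⟨window x n' d, window x (n' + (d + ℓ : ℕ)) e, by rw [window_add, window_add]⟩

@[simp]
theorem translate_zero (x : ℤ → α) : translate 0 x = x := by
  funext i; simp [translate]

theorem translate_translate (m n : ℤ) (x : ℤ → α) :
    translate m (translate n x) = translate (m + n) x := by
  funext i; simp [translate, add_assoc]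

theorem translate_injective (n : ℤ) : Function.Injective (translate n : (ℤ → α) → ℤ → α) := by
  intro x y h
  have := congrArg (translate (-n)) h
  simpa [translate_translate] using this

/-- The position at which the image of the letter `y_i` starts in the image of `y`. -/
def cut (σ : α → List β) (y : ℤ → α) : ℤ → ℤ
  | Int.ofNat i => ((window y 0 i).flatMap σ).length
  | Int.negSucc i => -(((window y (-((i : ℤ) + 1)) (i + 1)).flatMap σ).length : ℤ)

@[simp]
theorem cut_zero (σ : α → List β) (y : ℤ → α) : cut σ y 0 = 0 := rfl

theorem cut_add_one (σ : α → List β) (y : ℤ → α) (i : ℤ) :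
    cut σ y (i + 1) = cut σ y i + (σ (y i)).length := by
  rcases i with i | i
  · change cut σ y (Int.ofNat (i + 1)) = _
    simp only [cut, window_add, window_one, List.flatMap_append, List.length_append]
    simp
  · rw [Int.negSucc_eq, show -((i : ℤ) + 1) + 1 = -(i : ℤ) by ring]
    have h : cut σ y (-(i : ℤ)) = -(((window y (-(i : ℤ)) i).flatMap σ).length : ℤ) := by
      rcases i with - | i
      · rfl
      · exact_mod_cast rfl
    have h' : cut σ y (-((i : ℤ) + 1)) =
        -(((window y (-((i : ℤ) + 1)) (1 + i)).flatMap σ).length : ℤ) := by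
      rw [add_comm 1 i, ← Int.negSucc_eq, cut, Int.negSucc_eq]
    rw [h, h', window_add, window_one, List.flatMap_append, List.length_append]
    simp [add_assoc]

theorem cut_add (σ : α → List β) (y : ℤ → α) (i : ℤ) (d : ℕ) :
    cut σ y (i + d) = cut σ y i + ((window y i d).flatMap σ).length := by
  induction d with
  | zero => simp
  | succ d ih =>
    rw [Nat.cast_succ, ← add_assoc, cut_add_one, ih, window_add, window_one]
    simp [add_assoc]

theorem cut_strictMono {σ : α → List β} {y : ℤ → α} (h : ∀ i, σ (y i) ≠ []) :
    StrictMono (cut σ y) := by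
  refine strictMono_int_of_lt_succ fun i => ?_
  rw [cut_add_one]
  have := List.length_pos_iff.2 (h i)
  omega

theorem exists_eq_cut_add {σ : α → List β} {y : ℤ → α} {c : ℤ → ℤ} (h0 : c 0 = 0)
    (hc : ∀ i, c (i + 1) = c i + (σ (y i)).length) (h : ∀ i, σ (y i) ≠ []) (t : ℤ) :
    ∃ (i : ℤ) (r : ℕ), r < (σ (y i)).length ∧ t = c i + r := by
  induction t using Int.induction_on with
  | zero => exact ⟨0, 0, List.length_pos_iff.2 (h 0), by simp [h0]⟩
  | succ t ih =>
    obtain ⟨i, r, hr, ht⟩ := ih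
    rcases Nat.lt_or_ge (r + 1) (σ (y i)).length with h1 | h1
    · exact ⟨i, r + 1, h1, by push_cast; omega⟩
    · refine ⟨i + 1, 0, List.length_pos_iff.2 (h _), ?_⟩
      rw [hc]; push_cast; omega
  | pred t ih =>
    obtain ⟨i, r, hr, ht⟩ := ih
    rcases r with - | r
    · have h1 := List.length_pos_iff.2 (h (i - 1))
      have h2 := hc (i - 1)
      rw [sub_add_cancel] at h2
      exact ⟨i - 1, (σ (y (i - 1))).length - 1, by omega, by push_cast at *; omega⟩
    · exact ⟨i, r, by omega, by push_cast at *; omega⟩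

/-- This is why the default value in `extend` is harmless: the images of `ℓ` letters already cover
`ℓ` coordinates. -/
theorem le_length_flatMap {σ : α → List β} {y : ℤ → α} (h : ∀ i, σ (y i) ≠ []) (n : ℤ) (ℓ : ℕ) :
    ℓ ≤ ((window y n ℓ).flatMap σ).length := by
  have h1 := (cut_strictMono h)
  have h2 : ∀ d : ℕ, (d : ℤ) ≤ cut σ y (n + d) - cut σ y n := by
    intro d
    induction d with
    | zero => simp
    | succ d ih =>
      have := List.length_pos_iff.2 (h (n + d))
      rw [Nat.cast_succ, ← add_assoc, cut_add_one]
      omega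
  have := h2 ℓ
  rw [cut_add] at this
  omega

variable [Inhabited α]

theorem extend_cut_add {σ : α → List α} {y : ℤ → α} (h : ∀ i, σ (y i) ≠ []) (i : ℤ) (r : ℕ)
    (hr : r < (σ (y i)).length) : extend σ y (cut σ y i + r) = (σ (y i))[r] := by
  rcases i with i | i
  · simp only [cut]
    set A := ((window y 0 i).flatMap σ).length with hA
    have hiA : i ≤ A := le_length_flatMap h 0 i
    change extend σ y (Int.ofNat (A + r)) = _
    -- At coordinate `A + r`, `extend` uses `A + r + 1` letters, at least the `i + 1` that are
    -- needed; the `e` surplus letters lie further to the right.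
    obtain ⟨e, he⟩ : ∃ e, A + r + 1 = i + 1 + e := ⟨A + r - i, by omega⟩
    rw [extend, he, window_add, window_add, window_one, List.flatMap_append, List.flatMap_append,
      List.append_assoc, List.getD_eq_getElem?_getD, List.getElem?_append_right (by omega)]
    have : A + r - A = r := by omega
    rw [← hA, this, List.getElem?_append_left (by simpa using hr)]
    simp at hr ⊢
    simp [List.getElem?_eq_getElem hr]
  · simp only [cut]
    set G := (window y (-((i : ℤ) + 1)) (i + 1)).flatMap σ with hG
    have hGe : G = σ (y (Int.negSucc i)) ++ (window y (-(i : ℤ)) i).flatMap σ := by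
      rw [hG, add_comm i 1, window_add, window_one, List.flatMap_append, Int.negSucc_eq]
      simp
    have hrest := le_length_flatMap h (-(i : ℤ)) i
    have hlen := congrArg List.length hGe
    rw [List.length_append] at hlen
    -- The coordinate is `-(t + 1)`, for which `extend` reads the `t + 1` letters to the left of the
    -- origin; those beyond `y_{-(i+1)}` disappear past the end of the reversed word.
    obtain ⟨t, ht⟩ : ∃ t, G.length = t + 1 + r := ⟨G.length - (r + 1), by omega⟩
    have hit : i ≤ t := by omega
    have : (-(G.length : ℤ) + r) = Int.negSucc t := by
      rw [Int.negSucc_eq]; push_cast [ht]; ring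
    rw [this, extend]
    obtain ⟨e, rfl⟩ := Nat.exists_eq_add_of_le hit
    have hw : window y (-(((i + e : ℕ) : ℤ) + 1)) (i + e + 1) =
        window y (-(((i + e : ℕ) : ℤ) + 1)) e ++ window y (-((i : ℤ) + 1)) (i + 1) := by
      rw [show i + e + 1 = e + (i + 1) by ring, window_add]
      congr 2
      push_cast; ring
    rw [hw, List.flatMap_append, List.reverse_append, ← hG, List.getD_eq_getElem?_getD,
      List.getElem?_append_left (by simp; omega), List.getElem?_reverse (by omega)]
    have h3 : G.length - 1 - (i + e) = r := by omega
    rw [h3, hGe, List.getElem?_append_left hr, List.getElem?_eq_getElem hr]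
    rfl

theorem window_extend_cut {σ : α → List α} {y : ℤ → α} (h : ∀ i, σ (y i) ≠ []) (i : ℤ) (d : ℕ) :
    window (extend σ y) (cut σ y i) ((window y i d).flatMap σ).length =
      (window y i d).flatMap σ := by
  induction d with
  | zero => simp
  | succ d ih =>
    rw [window_add y, List.flatMap_append, List.length_append, window_add, ih, ← cut_add,
      window_one]
    congr 1
    rw [window_eq_iff]
    refine ⟨rfl, fun r hr => ?_⟩
    simp only [List.flatMap_singleton] at hr ⊢
    exact extend_cut_add h _ _ hr

theorem window_extend_cut_one {σ : α → List α} {y : ℤ → α} (h : ∀ i, σ (y i) ≠ []) (i : ℤ) :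
    window (extend σ y) (cut σ y i) (σ (y i)).length = σ (y i) := by
  simpa [window_one] using window_extend_cut h i 1

/-- The image of `y` is the only sequence that is cut into the images of the letters of `y`. -/
theorem eq_extend {σ : α → List α} {y x : ℤ → α} (h : ∀ i, σ (y i) ≠ []) {c : ℤ → ℤ}
    (h0 : c 0 = 0) (hc : ∀ i, c (i + 1) = c i + (σ (y i)).length)
    (hx : ∀ i, window x (c i) (σ (y i)).length = σ (y i)) : x = extend σ y := by
  have hcut : ∀ i, c i = cut σ y i := by
    intro i
    induction i using Int.induction_on with
    | zero => simp [h0]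
    | succ i ih => rw [hc, cut_add_one, ih]
    | pred i ih =>
      have h1 := hc (-(i : ℤ) - 1)
      have h2 := cut_add_one σ y (-(i : ℤ) - 1)
      rw [sub_add_cancel] at h1 h2
      omega
  funext t
  obtain ⟨i, r, hr, rfl⟩ := exists_eq_cut_add h0 hc h t
  have := ((window_eq_iff _ _ _ _).1 (hx i)).2 r hr
  rw [this, hcut, extend_cut_add h i r hr]

theorem extend_translate {σ : α → List α} {y : ℤ → α} (h : ∀ i, σ (y i) ≠ []) (j : ℤ) :
    extend σ (translate j y) = translate (cut σ y j) (extend σ y) := by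
  symm
  refine eq_extend (c := fun i => cut σ y (i + j) - cut σ y j) (fun i => h _) (by simp) ?_ ?_
  · intro i
    rw [add_right_comm, cut_add_one]
    simp only [translate]; ring
  · intro i
    rw [window_translate, sub_add_cancel]
    exact window_extend_cut_one h (i + j)

/-- By the uniqueness in `eq_extend`, it suffices to cut the right-hand side at the `σ`-cuts of the
`ρ`-cuts. -/
theorem extend_flatMap {σ ρ : α → List α} {y : ℤ → α} (hρ : ∀ i, ρ (y i) ≠ [])
    (hσ : ∀ i, σ (extend ρ y i) ≠ []) :
    extend (fun a => (ρ a).flatMap σ) y = extend σ (extend ρ y) := by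
  symm
  have key : ∀ i, window (extend ρ y) (cut ρ y i) (ρ (y i)).length = ρ (y i) :=
    window_extend_cut_one hρ
  refine eq_extend (c := fun i => cut σ (extend ρ y) (cut ρ y i)) ?_ (by simp) ?_ ?_
  · intro i hi
    have h1 := le_length_flatMap hσ (cut ρ y i) (ρ (y i)).length
    rw [key, hi] at h1
    exact hρ i (List.length_eq_zero_iff.1 (Nat.le_zero.1 h1))
  · intro i
    rw [cut_add_one, cut_add, key]
  · intro i
    have := window_extend_cut hσ (cut ρ y i) (ρ (y i)).length
    rwa [key] at this

theorem extend_singleton (y : ℤ → α) : extend (fun a => [a]) y = y :=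
  (eq_extend (c := id) (by simp) rfl (by simp) fun i => by simp [window_one]).symm

/-! ### Periods and recognizability. -/

theorem translate_extend_eq_self_of_periodic {σ : α → List α} {y : ℤ → α} (h : ∀ i, σ (y i) ≠ [])
    {p : ℕ} (hp : 0 < p) (hy : translate p y = y) :
    ∃ p' : ℕ, 0 < p' ∧ translate p' (extend σ y) = extend σ y := by
  have h1 := extend_translate h p
  rw [hy] at h1
  have h2 := cut_strictMono h (show (0 : ℤ) < p by exact_mod_cast hp)
  rw [cut_zero] at h2
  refine ⟨(cut σ y p).toNat, by omega, ?_⟩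
  rw [Int.toNat_of_nonneg h2.le, ← h1]

/-- Every point has at most one expression as a translate of the image of a point `z` of `Y` by a
nonnegative integer less than the length of the image of `z_0`. -/
def RecognizableOn (σ : α → List α) (Y : Set (ℤ → α)) : Prop :=
  ∀ z ∈ Y, ∀ z' ∈ Y, ∀ k k' : ℕ, k < (σ (z 0)).length → k' < (σ (z' 0)).length →
    translate k (extend σ z) = translate k' (extend σ z') → k = k' ∧ z = z'

theorem recognizableOn_singleton (Y : Set (ℤ → α)) : RecognizableOn (fun a => [a]) Y := by
  intro z _ z' _ k k' hk hk' h
  simp only [List.length_singleton, Nat.lt_one_iff] at hk hk'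
  subst hk hk'
  simpa [extend_singleton] using h

/-- For recognizability, it suffices to recover the letter at the origin. -/
theorem recognizableOn_of_letter {σ : α → List α} {Y : Set (ℤ → α)}
    (hY : ∀ j, ∀ z ∈ Y, translate j z ∈ Y) (h : ∀ z ∈ Y, ∀ i, σ (z i) ≠ [])
    (H : ∀ z ∈ Y, ∀ z' ∈ Y, ∀ k k' : ℕ, k < (σ (z 0)).length → k' < (σ (z' 0)).length →
      translate k (extend σ z) = translate k' (extend σ z') → k = k' ∧ z 0 = z' 0) :
    RecognizableOn σ Y := by
  intro z hz z' hz' k k' hk hk' he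
  obtain ⟨rfl, h0⟩ := H z hz z' hz' k k' hk hk' he
  refine ⟨rfl, ?_⟩
  have he' : extend σ z = extend σ z' := translate_injective _ he
  have key : ∀ i, z i = z' i ∧
      extend σ (translate i z) = extend σ (translate i z') := by
    intro i
    induction i using Int.induction_on with
    | zero => exact ⟨h0, by simpa using he'⟩
    | succ i ih =>
      -- The letters at `i` agree, so both images are translated by the same length.
      have h2 : extend σ (translate (i + 1) z) = extend σ (translate (i + 1) z') := by
        have e1 := extend_translate (h _ (hY i z hz)) 1
        have e2 := extend_translate (h _ (hY i z' hz')) 1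
        have c1 := cut_add_one σ (translate (i : ℤ) z) 0
        have c2 := cut_add_one σ (translate (i : ℤ) z') 0
        simp only [translate, zero_add, cut_zero] at c1 c2
        rw [translate_translate, add_comm] at e1 e2
        rw [e1, e2, ih.2]
        congr 1
        erw [c1, c2]
        rw [ih.1]
      refine ⟨?_, h2⟩
      have := (H _ (hY (i + 1) z hz) _ (hY (i + 1) z' hz') 0 0
        (List.length_pos_iff.2 (h _ (hY _ _ hz) _))
        (List.length_pos_iff.2 (h _ (hY _ _ hz') _)) (by rw [h2])).2
      simpa [translate] using this
    | pred i ih =>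
      set j : ℤ := -(i : ℤ) - 1 with hj
      have hji : -(i : ℤ) = 1 + j := by omega
      have aux : ∀ z ∈ Y, extend σ (translate (-(i : ℤ)) z) =
          translate (σ (z j)).length (extend σ (translate j z)) := by
        intro z hz
        have e1 := extend_translate (h _ (hY j z hz)) 1
        have c1 := cut_add_one σ (translate j z) 0
        rw [translate_translate, ← hji] at e1
        rw [e1]
        congr 1
        simpa [translate] using c1
      have pos : ∀ z ∈ Y, 0 < (σ (z j)).length := fun z hz => List.length_pos_iff.2 (h z hz j)
      have p1 := pos z hz
      have p2 := pos z' hz'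
      have e := ih.2
      rw [aux z hz, aux z' hz'] at e
      have e' := congrArg (translate (-1)) e
      rw [translate_translate, translate_translate] at e'
      -- Going backwards, the lengths of the two images are not yet known to agree. The coordinate
      -- just before the common cut is the last one of both blocks, whence the offsets `length - 1`.
      have := H _ (hY j z hz) _ (hY j z' hz') ((σ (z j)).length - 1) ((σ (z' j)).length - 1)
        (by simp only [translate, zero_add]; omega) (by simp only [translate, zero_add]; omega)
        (by
          convert e' using 2
          · omega
          · omega)
      have hzz : z j = z' j := by simpa [translate] using this.2
      refine ⟨hzz, ?_⟩
      rw [hzz] at e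
      exact translate_injective _ e
  exact funext fun i => (key i).1

/-- An offset in the composed image splits into a number `i` of complete `σ`-blocks and an offset
`r` in the next one. Recognizability of `σ` determines `r` and the translate of the `ρ`-image by
`i`; recognizability of `ρ` then determines `i` and the point. -/
theorem RecognizableOn.flatMap {σ ρ : α → List α} {Y Z : Set (ℤ → α)}
    (hσ : RecognizableOn σ Y) (hρ : RecognizableOn ρ Z) (hY : ∀ j, ∀ y ∈ Y, translate j y ∈ Y)
    (hZY : ∀ z ∈ Z, extend ρ z ∈ Y) (hσe : ∀ y ∈ Y, ∀ i, σ (y i) ≠ [])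
    (hρe : ∀ z ∈ Z, ∀ i, ρ (z i) ≠ []) : RecognizableOn (fun a => (ρ a).flatMap σ) Z := by
  have key : ∀ z ∈ Z, ∀ k : ℕ, k < ((ρ (z 0)).flatMap σ).length → ∃ i r : ℕ,
      i < (ρ (z 0)).length ∧ r < (σ (translate i (extend ρ z) 0)).length ∧
      (k : ℤ) = cut σ (extend ρ z) i + r ∧
      translate k (extend (fun a => (ρ a).flatMap σ) z) =
        translate r (extend σ (translate i (extend ρ z))) := by
    intro z hz k hk
    have hσz := hσe _ (hZY z hz)
    have hm := cut_strictMono hσz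
    obtain ⟨i, r, hr, hkr⟩ := exists_eq_cut_add (cut_zero σ (extend ρ z))
      (cut_add_one σ (extend ρ z)) hσz (k : ℤ)
    have hi0 : 0 ≤ i := by
      by_contra hi
      have h1 : cut σ (extend ρ z) (i + 1) ≤ cut σ (extend ρ z) 0 := hm.monotone (by omega)
      rw [cut_add_one, cut_zero] at h1
      omega
    lift i to ℕ using hi0
    refine ⟨i, r, ?_, by simpa [translate] using hr, hkr, ?_⟩
    · by_contra hi
      have h1 : cut σ (extend ρ z) (0 + ((ρ (z 0)).length : ℕ)) ≤ cut σ (extend ρ z) i :=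
        hm.monotone (by omega)
      rw [cut_add] at h1
      have h2 := window_extend_cut_one (hρe z hz) 0
      rw [cut_zero] at h2
      rw [h2, cut_zero] at h1
      omega
    · rw [extend_translate hσz, translate_translate, extend_flatMap (hρe z hz) hσz, hkr, add_comm]
  intro z hz z' hz' k k' hk hk' he
  obtain ⟨i, r, hi, hr, hkr, h1⟩ := key z hz k hk
  obtain ⟨i', r', hi', hr', hkr', h1'⟩ := key z' hz' k' hk'
  rw [h1, h1'] at he
  obtain ⟨rfl, he2⟩ := hσ _ (hY _ _ (hZY z hz)) _ (hY _ _ (hZY z' hz')) r r' hr hr' he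
  obtain ⟨rfl, rfl⟩ := hρ z hz z' hz' i i' hi hi' he2
  exact ⟨by omega, rfl⟩

end Symbolic

/-! ### Continuity: finite windows determine each coordinate of an image. -/

namespace Symbolic

variable {α : Type*}

section Topology

variable [TopologicalSpace α] [DiscreteTopology α]

theorem isClopen_setOf_window (n : ℤ) (ℓ : ℕ) (P : List α → Prop) :
    IsClopen {x : ℤ → α | P (window x n ℓ)} := by
  have hc : Continuous fun (x : ℤ → α) (i : Fin ℓ) => x (n + i) := by fun_prop
  have h : {x : ℤ → α | P (window x n ℓ)} =
      (fun (x : ℤ → α) (i : Fin ℓ) => x (n + i)) ⁻¹' {v | P (List.ofFn v)} := by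
    ext x
    have : window x n ℓ = List.ofFn fun i : Fin ℓ => x (n + i) :=
      (window_eq_iff _ _ _ _).2 ⟨by simp, fun i hi => by simp⟩
    simp only [Set.mem_ofPred_eq, Set.mem_preimage, this]
  rw [h]
  exact (isClopen_discrete _).preimage hc

theorem continuous_extend [Inhabited α] (σ : α → List α) : Continuous (extend σ) := by
  refine continuous_pi fun t => ?_
  refine (IsLocallyConstant.iff_isOpen_fiber.2 fun b => ?_).continuous
  rcases t with i | i
  · exact (isClopen_setOf_window 0 (i + 1) fun w => (w.flatMap σ).getD i default = b).isOpen
  · exact (isClopen_setOf_window (-((i : ℤ) + 1)) (i + 1)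
      fun w => (w.flatMap σ).reverse.getD i default = b).isOpen

end Topology

end Symbolic

/-! ### Subshifts of the levels of a directive sequence. -/

namespace DirectiveSequence

open Symbolic

variable {α : Type*} (τ : DirectiveSequence α)

/-- The definition of `comp` splits off the morphism of highest index; passing between the languages
of levels `n` and `n + 1` requires splitting off the lowest one. -/
theorem comp_succ_eq_flatMap_map (n k : ℕ) (a : α) :
    τ.comp n (k + 1) a = (τ.comp (n + 1) k a).flatMap (τ.map n) := by
  induction k generalizing a with
  | zero => simp [comp]
  | succ k ih =>
    rw [comp, comp, List.flatMap_assoc, show n + (k + 1) = n + 1 + k by ring]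
    exact congrArg (fun g => (τ.map (n + 1 + k) a).flatMap g) (funext ih)

theorem mem_alphabet_of_mem_comp {n k : ℕ} {a b : α} (ha : a ∈ τ.alphabet (n + k))
    (hb : b ∈ τ.comp n k a) : b ∈ τ.alphabet n := by
  induction k generalizing a with
  | zero => simp only [comp, List.mem_singleton] at hb; exact hb ▸ ha
  | succ k ih =>
    simp only [comp, List.mem_flatMap] at hb
    obtain ⟨c, hc, hb⟩ := hb
    exact ih (τ.map_mem (n + k) a ha c hc) hb

theorem comp_ne_nil {n k : ℕ} {a : α} (ha : a ∈ τ.alphabet (n + k)) : τ.comp n k a ≠ [] := by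
  induction k generalizing a with
  | zero => simp [comp]
  | succ k ih =>
    obtain ⟨b, hb⟩ := List.exists_mem_of_ne_nil _ (τ.map_ne_nil (n + k) a ha)
    rw [comp, Ne, List.flatMap_eq_nil_iff]
    exact fun h => ih (τ.map_mem (n + k) a ha b hb) (h b hb)

theorem comp_zero_succ (m : ℕ) : τ.comp 0 (m + 1) = fun a => (τ.map m a).flatMap (τ.comp 0 m) := by
  funext a
  rw [comp, zero_add]

theorem comp_zero_zero : τ.comp 0 0 = fun a => [a] := rfl

variable {τ}

theorem comp_zero_ne_nil {m : ℕ} {z : ℤ → α} (hz : z ∈ τ.levelSubshift m) (i : ℤ) :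
    τ.comp 0 m (z i) ≠ [] :=
  τ.comp_ne_nil (by rw [zero_add]; exact hz.1 i)

theorem map_ne_nil_of_mem {m : ℕ} {z : ℤ → α} (hz : z ∈ τ.levelSubshift (m + 1)) (i : ℤ) :
    τ.map m (z i) ≠ [] :=
  τ.map_ne_nil m _ (hz.1 i)

theorem levelLanguage_of_infix {m : ℕ} {u v : List α} (hv : v ∈ τ.levelLanguage m)
    (h : u <:+: v) : u ∈ τ.levelLanguage m := by
  obtain ⟨k, hk, a, ha, hva⟩ := hv
  exact ⟨k, hk, a, ha, h.trans hva⟩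

theorem flatMap_mem_levelLanguage {m : ℕ} {u : List α} (hu : u ∈ τ.levelLanguage (m + 1)) :
    u.flatMap (τ.map m) ∈ τ.levelLanguage m := by
  obtain ⟨k, hk, a, ha, s, t, hst⟩ := hu
  refine ⟨k + 1, by omega, a, by rwa [show m + (k + 1) = m + 1 + k by ring], ?_⟩
  rw [comp_succ_eq_flatMap_map, ← hst]
  simp only [List.flatMap_append]
  exact ⟨_, _, rfl⟩

theorem translate_mem_levelSubshift {m : ℕ} (j : ℤ) {z : ℤ → α} (hz : z ∈ τ.levelSubshift m) :
    Symbolic.translate j z ∈ τ.levelSubshift m := by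
  refine ⟨fun i => hz.1 _, ?_⟩
  rintro _ ⟨n, ℓ, rfl⟩
  exact hz.2 ⟨n + j, ℓ, window_translate z j n ℓ⟩

section Topology

variable [TopologicalSpace α] [DiscreteTopology α]

theorem isCompact_levelSubshift {m : ℕ} (h : (τ.alphabet m).Finite) :
    IsCompact (τ.levelSubshift m) := by
  have hK : IsCompact {x : ℤ → α | ∀ i, x i ∈ τ.alphabet m} := by
    have := isCompact_univ_pi fun _ : ℤ => h.isCompact
    convert this using 1
    ext x; simp
  have hC : IsClosed {x : ℤ → α | language x ⊆ τ.levelLanguage m} := by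
    have : {x : ℤ → α | language x ⊆ τ.levelLanguage m} =
        ⋂ n, ⋂ ℓ, {x | window x n ℓ ∈ τ.levelLanguage m} := by
      ext x
      simp only [Set.mem_ofPred_eq, Set.mem_iInter]
      exact ⟨fun H n ℓ => H ⟨n, ℓ, rfl⟩, by rintro H _ ⟨n, ℓ, rfl⟩; exact H n ℓ⟩
    rw [this]
    exact isClosed_iInter fun n => isClosed_iInter fun ℓ =>
      (isClopen_setOf_window n ℓ (· ∈ τ.levelLanguage m)).isClosed
  exact hK.inter_right hC

end Topology

variable [Inhabited α]

theorem extend_map_mem_levelSubshift {m : ℕ} {z : ℤ → α} (hz : z ∈ τ.levelSubshift (m + 1)) :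
    extend (τ.map m) z ∈ τ.levelSubshift m := by
  have hne := map_ne_nil_of_mem hz
  have hex := exists_eq_cut_add (cut_zero (τ.map m) z) (cut_add_one (τ.map m) z) hne
  constructor
  · intro t
    obtain ⟨i, r, hr, rfl⟩ := hex t
    rw [extend_cut_add hne i r hr]
    exact τ.map_mem m _ (hz.1 i) _ (List.getElem_mem _)
  · rintro _ ⟨n, ℓ, rfl⟩
    obtain ⟨i, r, hr, rfl⟩ := hex n
    refine levelLanguage_of_infix (flatMap_mem_levelLanguage (hz.2 ⟨i, r + ℓ, rfl⟩)) ?_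
    rw [← window_extend_cut hne]
    have := le_length_flatMap hne i (r + ℓ)
    exact window_infix_window _ (by omega) (by omega)

theorem extend_comp_succ {m : ℕ} {z : ℤ → α} (hz : z ∈ τ.levelSubshift (m + 1)) :
    extend (τ.comp 0 (m + 1)) z = extend (τ.comp 0 m) (extend (τ.map m) z) := by
  rw [comp_zero_succ]
  exact extend_flatMap (map_ne_nil_of_mem hz) (comp_zero_ne_nil (extend_map_mem_levelSubshift hz))

theorem extend_comp_mem_levelSubshift {m : ℕ} {z : ℤ → α} (hz : z ∈ τ.levelSubshift m) :
    extend (τ.comp 0 m) z ∈ τ.levelSubshift 0 := by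
  induction m generalizing z with
  | zero => rwa [comp_zero_zero, extend_singleton]
  | succ m ih =>
    rw [extend_comp_succ hz]
    exact ih (extend_map_mem_levelSubshift hz)

theorem recognizableOn_comp (h : ∀ m, RecognizableOn (τ.map m) (τ.levelSubshift (m + 1))) (m : ℕ) :
    RecognizableOn (τ.comp 0 m) (τ.levelSubshift m) := by
  induction m with
  | zero => exact recognizableOn_singleton _
  | succ m ih =>
    rw [comp_zero_succ]
    exact ih.flatMap (h m) (fun j y => translate_mem_levelSubshift j)
      (fun z => extend_map_mem_levelSubshift) (fun z hz => comp_zero_ne_nil hz)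
      (fun z hz => map_ne_nil_of_mem hz)

section Topology

variable [TopologicalSpace α] [DiscreteTopology α]

theorem isCompact_base {m : ℕ} (h : (τ.alphabet m).Finite) (a : α) :
    IsCompact (τ.base m a) := by
  refine IsCompact.image ?_ (continuous_extend _)
  refine (isCompact_levelSubshift h).inter_right (t := {x | x 0 = a}) ?_
  exact isClosed_singleton.preimage (continuous_apply 0)

end Topology

end DirectiveSequence

/-! ### Desubstitution: the towers cover the subshift. -/

namespace Symbolic

theorem cut_add_le {α β : Type*} {σ : α → List β} {y : ℤ → α} {H : ℕ}
    (h : ∀ i, (σ (y i)).length ≤ H) (i : ℤ) (d : ℕ) : cut σ y (i + d) ≤ cut σ y i + H * d := by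
  induction d with
  | zero => simp
  | succ d ih =>
    have h1 : ((σ (y (i + d))).length : ℤ) ≤ H := by exact_mod_cast h _
    rw [Nat.cast_succ, ← add_assoc, cut_add_one]
    linarith

end Symbolic

namespace DirectiveSequence

open Symbolic

variable {α : Type*} {τ : DirectiveSequence α} [Inhabited α]

/-- A point of the subshift of level `m` agrees, on arbitrarily large windows, with a translate of
the image of a sequence that has admissible large windows. -/
theorem exists_desubstitution_on_window {m : ℕ} (hfin : (τ.alphabet (m + 1)).Finite) {x : ℤ → α}
    (hx : x ∈ τ.levelSubshift m) (n : ℕ) :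
    ∃ (z : ℤ → α) (k : ℕ), (∀ i, z i ∈ τ.alphabet (m + 1)) ∧ k < (τ.map m (z 0)).length ∧
      window z (-(n : ℤ)) (2 * n + 1) ∈ τ.levelLanguage (m + 1) ∧
      ∀ t : ℤ, |t| ≤ n → Symbolic.translate k (extend (τ.map m) z) t = x t := by
  obtain ⟨H, hH⟩ : ∃ H, ∀ a ∈ τ.alphabet (m + 1), (τ.map m a).length ≤ H := by
    obtain ⟨H, hH⟩ := (hfin.image fun a => (τ.map m a).length).bddAbove
    exact ⟨H, fun a ha => hH ⟨a, ha, rfl⟩⟩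
  -- Images of letters have length at most `H`, so this radius leaves room for `n` letters on each
  -- side of the one whose image covers the centre.
  set R := H * (n + 1) with hR
  obtain ⟨k, hk, a, ha, s, t, hst⟩ := hx.2 ⟨-(R : ℤ), 2 * R + 1, rfl⟩
  obtain ⟨k, rfl⟩ : ∃ k', k = k' + 1 := ⟨k - 1, by omega⟩
  have ha' : a ∈ τ.alphabet (m + 1 + k) := by rwa [show m + 1 + k = m + (k + 1) by ring]
  rw [comp_succ_eq_flatMap_map] at hst
  set u := τ.comp (m + 1) k a with hu
  have hlen := congrArg List.length hst
  simp only [List.length_append, length_window] at hlen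
  have hmem : ∀ b ∈ u, b ∈ τ.alphabet (m + 1) := fun b hb => τ.mem_alphabet_of_mem_comp ha' hb
  obtain ⟨b, hb⟩ := List.exists_mem_of_ne_nil _ (τ.comp_ne_nil ha')
  have hHpos : 0 < H :=
    (List.length_pos_iff.2 (τ.map_ne_nil m b (hmem b hb))).trans_le (hH b (hmem b hb))
  -- `levelLanguage` asks for a positive number of morphisms. If `k = 0`, the window of length `2R +
  -- 1` would fit into the image of one letter, of length at most `H`.
  have hk0 : 0 < k := by
    by_contra hk0
    obtain rfl : k = 0 := by omega
    have h1 := hH a ha'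
    simp only [hu, comp, List.flatMap_cons, List.flatMap_nil, List.append_nil] at hlen
    nlinarith
  -- Outside `u` the sequence is filled with letters of `u`, so that all its letters are admissible.
  set z₀ : ℤ → α := fun i => u.getD i.toNat b with hz₀
  have hz₀mem : ∀ i, z₀ i ∈ τ.alphabet (m + 1) := by
    intro i
    simp only [hz₀, List.getD_eq_getElem?_getD]
    by_cases h : i.toNat < u.length
    · rw [List.getElem?_eq_getElem h]
      exact hmem _ (List.getElem_mem h)
    · rw [List.getElem?_eq_none (by omega)]
      exact hmem b hb
  have hne : ∀ i, τ.map m (z₀ i) ≠ [] := fun i => τ.map_ne_nil m _ (hz₀mem i)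
  have hwu : window z₀ 0 u.length = u := by
    refine (window_eq_iff _ _ _ _).2 ⟨rfl, fun i hi => ?_⟩
    simp [hz₀, List.getElem?_eq_getElem hi]
  have hwv := window_extend_cut hne 0 u.length
  rw [hwu, cut_zero, ← hst] at hwv
  have hval : ∀ i : ℕ, i < 2 * R + 1 → extend (τ.map m) z₀ (s.length + i) = x (-(R : ℤ) + i) := by
    intro i hi
    have := ((window_eq_iff _ _ _ _).1 hwv).2 (s.length + i) (by simp; omega)
    rw [zero_add] at this
    push_cast at this
    rw [this, List.getElem_append_left (by simp; omega), List.getElem_append_right (by omega),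
      getElem_window]
    simp
  obtain ⟨j, r, hr, hjr⟩ := exists_eq_cut_add (cut_zero (τ.map m) z₀) (cut_add_one (τ.map m) z₀)
    hne (s.length + R : ℤ)
  have hmono := cut_strictMono hne
  have hle : ∀ i, (τ.map m (z₀ i)).length ≤ H := fun i => hH _ (hz₀mem i)
  have hrH : (r : ℤ) + 1 ≤ H := by exact_mod_cast hr.trans_le (hle j)
  have hj0 : 0 ≤ j := by
    by_contra hj
    have h1 : cut (τ.map m) z₀ (j + 1) ≤ cut (τ.map m) z₀ 0 := hmono.monotone (by omega)
    rw [cut_add_one, cut_zero] at h1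
    have : 0 < R := by positivity
    omega
  lift j to ℕ using hj0
  have hnj : n ≤ j := by
    have h1 := cut_add_le hle 0 j
    rw [zero_add, cut_zero, zero_add] at h1
    have h2 : (H * (n + 1) : ℤ) < H * (j + 1) := by push_cast [hR] at hjr; linarith
    have := lt_of_mul_lt_mul_left h2 (by positivity)
    omega
  have hcu : cut (τ.map m) z₀ u.length = s.length + (2 * R + 1) + t.length := by
    have := cut_add (τ.map m) z₀ 0 u.length
    rw [hwu, cut_zero, zero_add, zero_add] at this
    rw [this]; exact_mod_cast hlen.symm
  have hju : j + n + 1 ≤ u.length := by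
    by_contra hcon
    have hc1 : cut (τ.map m) z₀ u.length ≤ cut (τ.map m) z₀ (j + n : ℕ) :=
      hmono.monotone (by omega)
    have h1 := cut_add_le hle j n
    push_cast at hc1
    push_cast [hR] at hcu hjr
    nlinarith
  refine ⟨Symbolic.translate j z₀, r, fun i => hz₀mem _, by simpa [Symbolic.translate] using hr,
    ⟨k, hk0, a, ha', ?_⟩, fun i hi => ?_⟩
  · rw [← hu, window_translate]
    conv_rhs => rw [← hwu]
    exact window_infix_window _ (by omega) (by push_cast; omega)
  · have hRn : n ≤ R := by nlinarith
    rw [abs_le] at hi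
    obtain ⟨d, hd⟩ := Int.eq_ofNat_of_zero_le (show 0 ≤ R + i by omega)
    have h1 := hval d (by omega)
    rw [extend_translate hne, translate_translate]
    simp only [Symbolic.translate]
    rw [show i + (r + cut (τ.map m) z₀ j) = s.length + d by omega, h1]
    congr 1
    omega

/-- Compactness: the offsets are bounded, and the approximate solutions on growing windows form a
decreasing sequence of nonempty compact sets of pairs `(z, k)`. A pair in their intersection is an
exact solution. -/
theorem exists_desubstitution {m : ℕ} (hfin : (τ.alphabet (m + 1)).Finite) {x : ℤ → α}
    (hx : x ∈ τ.levelSubshift m) :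
    ∃ z ∈ τ.levelSubshift (m + 1), ∃ k : ℕ, k < (τ.map m (z 0)).length ∧
      x = Symbolic.translate k (extend (τ.map m) z) := by
  let _ : TopologicalSpace α := ⊥
  have _ : DiscreteTopology α := ⟨rfl⟩
  obtain ⟨H, hH⟩ : ∃ H, ∀ a ∈ τ.alphabet (m + 1), (τ.map m a).length ≤ H := by
    obtain ⟨H, hH⟩ := (hfin.image fun a => (τ.map m a).length).bddAbove
    exact ⟨H, fun a ha => hH ⟨a, ha, rfl⟩⟩
  let K : Set ((ℤ → α) × ℕ) := {z | ∀ i, z i ∈ τ.alphabet (m + 1)} ×ˢ Set.Iio H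
  have hK : IsCompact K := by
    refine IsCompact.prod ?_ (Set.finite_Iio H).isCompact
    have := isCompact_univ_pi fun _ : ℤ => hfin.isCompact
    convert this using 1
    ext x; simp
  let A : ℕ → Set ((ℤ → α) × ℕ) := fun n => {p | p.2 < (τ.map m (p.1 0)).length} ∩
    {p | window p.1 (-(n : ℤ)) (2 * n + 1) ∈ τ.levelLanguage (m + 1)} ∩
    ⋂ t : ℤ, ⋂ _ : |t| ≤ n, {p | Symbolic.translate p.2 (extend (τ.map m) p.1) t = x t}
  have hA : ∀ n, IsClosed (A n) := by
    intro n
    refine IsClosed.inter (IsClosed.inter ?_ ?_)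
      (isClosed_iInter fun t => isClosed_iInter fun _ => ?_)
    · have : Continuous fun p : (ℤ → α) × ℕ => (p.2, p.1 0) := by fun_prop
      exact (isClosed_discrete {q : ℕ × α | q.1 < (τ.map m q.2).length}).preimage this
    · exact (isClopen_setOf_window _ _ (· ∈ τ.levelLanguage (m + 1))).isClosed.preimage
        continuous_fst
    · have : Continuous fun p : (ℤ → α) × ℕ =>
          Symbolic.translate p.2 (extend (τ.map m) p.1) t := by
        refine continuous_prod_of_discrete_right.2 fun k => ?_
        exact (continuous_apply (t + (k : ℤ))).comp (continuous_extend (τ.map m))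
      exact isClosed_singleton.preimage this
  have hanti : ∀ n, A (n + 1) ⊆ A n := by
    rintro n p ⟨⟨h1, h2⟩, h3⟩
    refine ⟨⟨h1, levelLanguage_of_infix h2 (window_infix_window _ ?_ ?_)⟩, ?_⟩
    · push_cast; omega
    · push_cast; omega
    · simp only [Set.mem_iInter] at h3 ⊢
      exact fun t ht => h3 t (ht.trans (by push_cast; omega))
  obtain ⟨⟨z, k⟩, hz⟩ := IsCompact.nonempty_iInter_of_sequence_nonempty_isCompact_isClosed
    (fun n => K ∩ A n) (fun n => Set.inter_subset_inter_right _ (hanti n))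
    (fun n => by
      obtain ⟨z, k, h1, h2, h3, h4⟩ := exists_desubstitution_on_window hfin hx n
      exact ⟨(z, k), ⟨h1, h2.trans_le (hH _ (h1 0))⟩, ⟨h2, h3⟩, by simpa using h4⟩)
    (hK.inter_right (hA 0)) fun n => hK.isClosed.inter (hA n)
  rw [Set.mem_iInter] at hz
  refine ⟨z, ⟨(hz 0).1.1, ?_⟩, k, (hz 0).2.1.1, ?_⟩
  · rintro _ ⟨n, ℓ, rfl⟩
    exact levelLanguage_of_infix (hz (n.natAbs + ℓ)).2.1.2
      (window_infix_window _ (by push_cast [-Int.natCast_natAbs]; omega)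
        (by push_cast [-Int.natCast_natAbs]; omega))
  · funext t
    have := (hz t.natAbs).2.2
    simp only [Set.mem_iInter] at this
    exact (this t (by simp)).symm

theorem exists_eq_translate_extend_comp (hfin : ∀ m, (τ.alphabet m).Finite) {x : ℤ → α}
    (hx : x ∈ τ.levelSubshift 0) (m : ℕ) :
    ∃ z ∈ τ.levelSubshift m, ∃ k : ℕ, k < τ.height m (z 0) ∧
      x = Symbolic.translate k (extend (τ.comp 0 m) z) := by
  induction m with
  | zero =>
    exact ⟨x, hx, 0, by simp [height, comp], by simp [comp_zero_zero, extend_singleton]⟩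
  | succ m ih =>
    obtain ⟨y, hy, k, hk, rfl⟩ := ih
    obtain ⟨z, hz, i, hi, rfl⟩ := exists_desubstitution (hfin (m + 1)) hy
    have hy' := extend_map_mem_levelSubshift hz
    have hne := comp_zero_ne_nil hy'
    have hmono := cut_strictMono hne
    have hpos : 0 ≤ cut (τ.comp 0 m) (extend (τ.map m) z) i := by
      rw [← cut_zero (τ.comp 0 m) (extend (τ.map m) z)]
      exact hmono.monotone (by omega)
    refine ⟨z, hz, k + (cut (τ.comp 0 m) (extend (τ.map m) z) i).toNat, ?_, ?_⟩
    · have h1 := cut_add (τ.comp 0 m) (extend (τ.map m) z) 0 (τ.map m (z 0)).length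
      have h2 := window_extend_cut_one (map_ne_nil_of_mem hz) 0
      rw [cut_zero] at h2
      rw [h2, cut_zero, zero_add, zero_add] at h1
      have h3 : cut (τ.comp 0 m) (extend (τ.map m) z) (i + 1) ≤
        cut (τ.comp 0 m) (extend (τ.map m) z) (τ.map m (z 0)).length := hmono.monotone (by omega)
      rw [cut_add_one] at h3
      rw [height, comp_zero_succ]
      simp only [height, Symbolic.translate, zero_add] at hk
      beta_reduce
      omega
    · rw [extend_comp_succ hz, extend_translate hne, Symbolic.translate_translate]
      congr 1

/-! ### Measures of bases and towers. -/

section Measure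

variable {τ : DirectiveSequence ℕ} {μ : Measure (ℤ → ℕ)}

theorem _root_.Symbolic.measurable_translate (k : ℤ) :
    Measurable (Symbolic.translate k : (ℤ → ℕ) → ℤ → ℕ) :=
  measurable_pi_lambda _ fun i => measurable_pi_apply (i + k)

theorem _root_.Symbolic.measurableSet_translate_image (k : ℤ) {B : Set (ℤ → ℕ)}
    (hB : MeasurableSet B) : MeasurableSet (Symbolic.translate k '' B) := by
  have : Symbolic.translate k '' B = Symbolic.translate (-k) ⁻¹' B := by
    ext x
    constructor
    · rintro ⟨y, hy, rfl⟩
      simpa [translate_translate] using hy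
    · intro hx
      exact ⟨_, hx, by simp [translate_translate]⟩
  rw [this]
  exact measurable_translate _ hB

theorem _root_.Symbolic.measure_translate_image (hinv : MeasurePreserving shift μ μ) (k : ℕ)
    {B : Set (ℤ → ℕ)} (hB : MeasurableSet B) : μ (Symbolic.translate k '' B) = μ B := by
  have hk : (Symbolic.translate k : (ℤ → ℕ) → ℤ → ℕ) = shift^[k] := by
    induction k with
    | zero => funext x; simp
    | succ k ih =>
      rw [Function.iterate_succ, ← ih]
      funext x i
      simp [Symbolic.translate, shift, add_assoc]
  have hp : MeasurePreserving (Symbolic.translate k) μ μ := hk ▸ hinv.iterate k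
  rw [← hp.measure_preimage (measurableSet_translate_image k hB).nullMeasurableSet,
    Set.preimage_image_eq _ (translate_injective _)]

theorem measurableSet_base (hfin : ∀ m, (τ.alphabet m).Finite) (m a : ℕ) :
    MeasurableSet (τ.base m a) :=
  (isCompact_base (hfin m) a).measurableSet

theorem eq_of_mem_translate_base {m : ℕ} (hrec : RecognizableOn (τ.comp 0 m) (τ.levelSubshift m))
    {a b k l : ℕ} (hk : k < τ.height m a) (hl : l < τ.height m b) {x : ℤ → ℕ}
    (hx : x ∈ Symbolic.translate k '' τ.base m a) (hx' : x ∈ Symbolic.translate l '' τ.base m b) :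
    a = b ∧ k = l := by
  obtain ⟨_, ⟨z, ⟨hz, rfl⟩, rfl⟩, rfl⟩ := hx
  obtain ⟨_, ⟨z', ⟨hz', rfl⟩, rfl⟩, h⟩ := hx'
  obtain ⟨rfl, rfl⟩ := hrec z' hz' z hz l k hl hk h
  exact ⟨rfl, rfl⟩

theorem measure_tower (hfin : ∀ m, (τ.alphabet m).Finite) {m : ℕ}
    (hrec : RecognizableOn (τ.comp 0 m) (τ.levelSubshift m))
    (hinv : MeasurePreserving shift μ μ) (a : ℕ) :
    μ (τ.tower m a) = τ.height m a * μ (τ.base m a) := by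
  have : τ.tower m a = ⋃ k : Fin (τ.height m a), Symbolic.translate (k : ℕ) '' τ.base m a := by
    ext x
    simp only [tower, Set.mem_iUnion]
    exact ⟨fun ⟨k, hk, hx⟩ => ⟨⟨k, hk⟩, hx⟩, fun ⟨k, hx⟩ => ⟨k, k.2, hx⟩⟩
  rw [this, measure_iUnion]
  · simp [measure_translate_image hinv _ (measurableSet_base hfin m a)]
  · intro k l hkl
    refine Set.disjoint_left.2 fun x hx hx' => hkl ?_
    exact Fin.ext (eq_of_mem_translate_base hrec k.2 l.2 hx hx').2
  · exact fun k => measurableSet_translate_image _ (measurableSet_base hfin m a)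

theorem measurableSet_tower (hfin : ∀ m, (τ.alphabet m).Finite) (m a : ℕ) :
    MeasurableSet (τ.tower m a) :=
  MeasurableSet.iUnion fun _ => MeasurableSet.iUnion fun _ =>
    measurableSet_translate_image _ (measurableSet_base hfin m a)

/-- The towers of level `m` are disjoint by recognizability and cover the subshift by
desubstitution. -/
theorem tsum_height_mul_measure_base [IsProbabilityMeasure μ] (hfin : ∀ m, (τ.alphabet m).Finite)
    {m : ℕ} (hrec : RecognizableOn (τ.comp 0 m) (τ.levelSubshift m))
    (hinv : MeasurePreserving shift μ μ) (hX : μ (τ.levelSubshift 0) = 1) :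
    ∑' a, (τ.height m a : ℝ≥0∞) * μ (τ.base m a) = 1 := by
  simp_rw [← measure_tower hfin hrec hinv]
  rw [← measure_iUnion]
  · refine le_antisymm prob_le_one (hX ▸ measure_mono fun x hx => ?_)
    obtain ⟨z, hz, k, hk, rfl⟩ := exists_eq_translate_extend_comp hfin hx m
    simp only [tower, Set.mem_iUnion]
    exact ⟨z 0, k, hk, _, ⟨z, ⟨hz, rfl⟩, rfl⟩, rfl⟩
  · intro a b hab
    refine Set.disjoint_left.2 fun x hx hx' => hab ?_
    simp only [tower, Set.mem_iUnion] at hx hx'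
    obtain ⟨k, hk, hx⟩ := hx
    obtain ⟨l, hl, hx'⟩ := hx'
    exact (eq_of_mem_translate_base hrec hk hl hx hx').1
  · exact measurableSet_tower hfin m

theorem _root_.List.card_subtype_getElem_eq {β : Type*} [DecidableEq β] (l : List β) (a : β) :
    Fintype.card {k : Fin l.length // l[k] = a} = l.count a := by
  rw [Fintype.card_subtype]
  exact Fin.card_filter_univ_eq_vector_get_eq_count a ⟨l, rfl⟩

theorem translate_extend_comp_succ {m k : ℕ} {z : ℤ → ℕ} (hz : z ∈ τ.levelSubshift (m + 1))
    (hk : k < (τ.map m (z 0)).length) :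
    Symbolic.translate ((((τ.map m (z 0)).take k).flatMap (τ.comp 0 m)).length : ℕ)
      (extend (τ.comp 0 (m + 1)) z) =
      extend (τ.comp 0 m) (Symbolic.translate k (extend (τ.map m) z)) ∧
    Symbolic.translate k (extend (τ.map m) z) 0 = (τ.map m (z 0))[k] := by
  have hy := extend_map_mem_levelSubshift hz
  have hw := window_extend_cut_one (map_ne_nil_of_mem hz) 0
  rw [cut_zero] at hw
  have hcut : cut (τ.comp 0 m) (extend (τ.map m) z) k =
      (((τ.map m (z 0)).take k).flatMap (τ.comp 0 m)).length := by
    have h1 := cut_add (τ.comp 0 m) (extend (τ.map m) z) 0 k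
    rw [zero_add, cut_zero, zero_add] at h1
    rw [h1]
    congr 3
    rw [← hw, window_eq_iff]
    refine ⟨by simp; omega, fun i hi => ?_⟩
    rw [List.getElem_take, getElem_window]
  refine ⟨by rw [extend_translate (comp_zero_ne_nil hy), extend_comp_succ hz, hcut], ?_⟩
  rw [← ((window_eq_iff _ _ _ _).1 hw).2 k hk]
  simp [Symbolic.translate]

/-- A point of the base over `a` lies in a tower of level `m + 1` over some `c`, at the height where
an occurrence of `a` in `τ_m(c)` begins. -/
theorem base_eq_iUnion (hfin : ∀ m, (τ.alphabet m).Finite) (m a : ℕ) :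
    τ.base m a = ⋃ p : Σ c, {k : Fin (τ.map m c).length // (τ.map m c)[k] = a},
      Symbolic.translate ((((τ.map m p.1).take p.2).flatMap (τ.comp 0 m)).length : ℕ) ''
        τ.base (m + 1) p.1 := by
  refine Set.Subset.antisymm ?_ (Set.iUnion_subset ?_)
  · rintro _ ⟨y, ⟨hy, rfl⟩, rfl⟩
    obtain ⟨z, hz, k, hk, rfl⟩ := exists_desubstitution (hfin (m + 1)) hy
    obtain ⟨h1, h2⟩ := translate_extend_comp_succ hz hk
    exact Set.mem_iUnion.2 ⟨⟨z 0, ⟨k, hk⟩, h2.symm⟩, _, ⟨z, ⟨hz, rfl⟩, rfl⟩, h1⟩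
  · rintro ⟨c, ⟨k, hk⟩, ha⟩ _ ⟨_, ⟨z, ⟨hz, rfl⟩, rfl⟩, rfl⟩
    obtain ⟨h1, h2⟩ := translate_extend_comp_succ hz hk
    exact ⟨_, ⟨translate_mem_levelSubshift k (extend_map_mem_levelSubshift hz), h2.trans ha⟩,
      h1.symm⟩

theorem length_flatMap_take_lt {m c k l : ℕ} (hc : c ∈ τ.alphabet (m + 1)) (hkl : k < l)
    (hl : l ≤ (τ.map m c).length) :
    (((τ.map m c).take k).flatMap (τ.comp 0 m)).length <
      (((τ.map m c).take l).flatMap (τ.comp 0 m)).length := by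
  obtain ⟨d, rfl⟩ := Nat.exists_eq_add_of_lt hkl
  have hk : k < (τ.map m c).length := by omega
  have hne : τ.comp 0 m (τ.map m c)[k] ≠ [] :=
    τ.comp_ne_nil (by rw [zero_add]; exact τ.map_mem m c hc _ (List.getElem_mem hk))
  have := List.length_pos_iff.2 hne
  rw [show k + d + 1 = k + (d + 1) by ring, List.take_add, List.drop_eq_getElem_cons hk,
    List.take_succ_cons, List.flatMap_append, List.flatMap_cons]
  simp only [List.length_append]
  omega

theorem base_eq_empty {m a : ℕ} (ha : a ∉ τ.alphabet m) : τ.base m a = ∅ := by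
  rw [Set.eq_empty_iff_forall_notMem]
  rintro _ ⟨z, ⟨hz, rfl⟩, rfl⟩
  exact ha (hz.1 0)

theorem measure_base (hfin : ∀ m, (τ.alphabet m).Finite) {m : ℕ}
    (hrec : RecognizableOn (τ.comp 0 (m + 1)) (τ.levelSubshift (m + 1)))
    (hinv : MeasurePreserving shift μ μ) (a : ℕ) :
    μ (τ.base m a) = ∑' c, ((τ.map m c).count a : ℝ≥0∞) * μ (τ.base (m + 1) c) := by
  rw [base_eq_iUnion hfin, measure_iUnion]
  · rw [ENNReal.tsum_sigma']
    refine tsum_congr fun c => ?_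
    simp only [measure_translate_image hinv _ (measurableSet_base hfin (m + 1) c)]
    rw [tsum_fintype, Finset.sum_const, Finset.card_univ, List.card_subtype_getElem_eq,
      nsmul_eq_mul]
  · rintro ⟨c, k, hk⟩ ⟨d, l, hl⟩ hne
    refine Set.disjoint_left.2 fun x hx hx' => hne ?_
    by_cases hc : c ∈ τ.alphabet (m + 1)
    swap
    · simp [base_eq_empty hc] at hx
    by_cases hd : d ∈ τ.alphabet (m + 1)
    swap
    · simp [base_eq_empty hd] at hx'
    have hlt : ∀ c ∈ τ.alphabet (m + 1), ∀ k : Fin (τ.map m c).length,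
        (((τ.map m c).take k).flatMap (τ.comp 0 m)).length < τ.height (m + 1) c := by
      intro c hc k
      have := length_flatMap_take_lt hc k.2 le_rfl
      rw [List.take_length] at this
      rw [height, comp_zero_succ]
      exact this
    obtain ⟨rfl, h⟩ := eq_of_mem_translate_base hrec (hlt c hc k) (hlt d hd l) hx hx'
    congr
    by_contra hkl
    rcases lt_or_gt_of_ne hkl with h1 | h1
    · exact (length_flatMap_take_lt hc h1 l.2.le).ne h
    · exact (length_flatMap_take_lt hc h1 k.2.le).ne h.symm
  · exact fun p => measurableSet_translate_image _ (measurableSet_base hfin (m + 1) p.1)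

end Measure

end DirectiveSequence

/-! ### Generating words and the morphisms `τ_n`. -/

namespace FerencziParameters

open Symbolic

variable {W : FerencziParameters}

theorem replicate_append_word_infix {n i : ℕ} (hi : i < W.q n) :
    W.word n ++ List.replicate (W.spacer n i) 1 ++ W.word n <:+: W.word (n + 1) := by
  -- Whatever remains of `w_{n+1}` after a spacer block begins with `w_n`.
  have hpre : ∀ k ≤ W.q n, ∃ s, ((List.range (W.q n - k)).flatMap fun j =>
      W.word n ++ List.replicate (W.spacer n (k + j)) 1) ++ W.word n = W.word n ++ s := by
    intro k _
    rcases W.q n - k with - | d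
    · exact ⟨[], by simp⟩
    · rw [List.range_succ_eq_map, List.flatMap_cons]
      exact ⟨_, by simp only [List.append_assoc]; rfl⟩
  obtain ⟨s, hs⟩ := hpre (i + 1) hi
  have hsplit : W.q n = i + 1 + (W.q n - (i + 1)) := by omega
  refine ⟨(List.range i).flatMap fun j => W.word n ++ List.replicate (W.spacer n j) 1, s, ?_⟩
  rw [word]
  conv_rhs => rw [hsplit]
  rw [List.range_add, List.range_succ, List.flatMap_append, List.flatMap_append, List.flatMap_map,
    List.append_assoc (List.flatMap _ _ ++ _), hs]
  simp

theorem word_suffix_word {n N : ℕ} (h : n ≤ N) : W.word n <:+ W.word N := by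
  induction N, h using Nat.le_induction with
  | base => exact List.suffix_rfl
  | succ N _ ih => exact ih.trans ⟨_, by rw [word]⟩

theorem spaced_word_prefix (n : ℕ) :
    W.word n ++ List.replicate (W.spacer n 0) 1 ++ W.word n <+: W.word (n + 1) := by
  obtain ⟨d, hd⟩ : ∃ d, W.q n = d + 1 + 1 := ⟨W.q n - 2, by have := W.standard n; omega⟩
  rw [word, hd, List.range_succ_eq_map, List.flatMap_cons, List.range_succ_eq_map, List.map_cons,
    List.flatMap_cons]
  simp only [List.append_assoc, List.prefix_append_right_inj]
  exact List.prefix_append _ _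

theorem word_prefix_word {n N : ℕ} (h : n ≤ N) : W.word n <+: W.word N := by
  induction N, h using Nat.le_induction with
  | base => exact List.prefix_rfl
  | succ N _ ih =>
    refine ih.trans (List.IsPrefix.trans ?_ (spaced_word_prefix N))
    rw [List.append_assoc]
    exact List.prefix_append _ _

theorem mem_word {n b : ℕ} (h : b ∈ W.word n) : b = 0 ∨ b = 1 := by
  induction n with
  | zero => simp only [word, List.mem_singleton] at h; exact Or.inl h
  | succ n ih =>
    simp only [word, List.mem_append, List.mem_flatMap, List.mem_replicate] at h
    rcases h with ⟨i, -, h | h⟩ | h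
    exacts [ih h, Or.inr h.2, ih h]

/-- The spacers are bounded, as otherwise the fixed point `1^∞` belongs to the subshift. -/
theorem exists_spacer_le (hap : IsAperiodic W.subshift) :
    ∃ M, ∀ n, ∀ i < W.q n, W.spacer n i ≤ M := by
  by_contra! hM
  refine hap (fun _ => 1) ?_ 1 one_pos rfl
  rintro _ ⟨n, ℓ, rfl⟩
  obtain ⟨N, i, hi, hlt⟩ := hM ℓ
  refine ⟨N + 1, List.IsInfix.trans ?_ (replicate_append_word_infix hi)⟩
  have h1 : window (fun _ => 1) n ℓ = List.replicate ℓ 1 := by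
    simp [window_eq_map_range]
  have h2 : List.replicate (W.spacer N i) 1 = List.replicate ℓ 1 ++
      List.replicate (W.spacer N i - ℓ) 1 := by
    rw [← List.replicate_add]; congr; omega
  exact ⟨W.word N, List.replicate (W.spacer N i - ℓ) 1 ++ W.word N, by
    rw [h1, h2]
    simp only [List.append_assoc]⟩

theorem alphabet_finite (hap : IsAperiodic W.subshift) (m : ℕ) :
    (W.directive.alphabet m).Finite := by
  rcases m with - | m
  · exact Set.toFinite {0, 1}
  · obtain ⟨M, hM⟩ := exists_spacer_le hap
    refine (Set.finite_Iic M).subset ?_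
    rintro _ ⟨N, -, i, hi, rfl⟩
    exact hM N i hi

theorem morphism_succ_eq (n b : ℕ) : W.morphism (n + 1) b =
    ((List.range (W.q n - 1)).map fun i => W.spacer n (i + 1)) ++ [b, W.spacer n 0] := by
  rw [morphism]

/-- The word `p` such that `w_n 1^b p = p τ_{[0,n+1)}(b)`. -/
def conjugator (W : FerencziParameters) : ℕ → List ℕ
  | 0 => []
  | n + 1 => W.word n ++ List.replicate (W.spacer n 0) 1 ++ conjugator W n

theorem conjugator_prefix (n : ℕ) : W.conjugator n <+: W.word n := by
  induction n with
  | zero => exact List.nil_prefix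
  | succ n ih =>
    rw [conjugator]
    exact ((List.prefix_append_right_inj _).2 ih).trans (spaced_word_prefix n)

theorem _root_.List.flatMap_append_of_conj {α β : Type*} {u v : α → List β} {p : List β}
    (h : ∀ b, u b ++ p = p ++ v b) (L : List α) : L.flatMap u ++ p = p ++ L.flatMap v := by
  induction L with
  | nil => simp
  | cons b L ih => rw [List.flatMap_cons, List.flatMap_cons, List.append_assoc, ih,
      ← List.append_assoc, h, List.append_assoc]

theorem comp_succ_succ (n b : ℕ) : W.directive.comp 0 (n + 2) b =
    (((List.range (W.q n - 1)).map fun i => W.spacer n (i + 1)) ++ [b, W.spacer n 0]).flatMap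
      (W.directive.comp 0 (n + 1)) := by
  rw [DirectiveSequence.comp_zero_succ]
  exact congrArg (fun l => List.flatMap _ l) (morphism_succ_eq n b)

theorem word_append_conjugator (n b : ℕ) : W.word n ++ List.replicate b 1 ++ W.conjugator n =
    W.conjugator n ++ W.directive.comp 0 (n + 1) b := by
  induction n generalizing b with
  | zero =>
    simp [word, conjugator, DirectiveSequence.comp, directive, morphism]
  | succ n ih =>
    obtain ⟨d, hd⟩ : ∃ d, W.q n = d + 1 := ⟨W.q n - 1, by have := W.standard n; omega⟩
    rw [conjugator, comp_succ_succ, List.append_assoc (_ ++ _) (W.conjugator n),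
      ← List.flatMap_append_of_conj ih, word, hd, List.range_succ_eq_map]
    simp [List.flatMap_map]

theorem comp_infix (n b : ℕ) : W.directive.comp 0 (n + 1) b <:+:
    W.word n ++ List.replicate b 1 ++ W.word n := by
  obtain ⟨s, hs⟩ := W.conjugator_prefix n
  refine ⟨W.conjugator n, s, ?_⟩
  rw [← word_append_conjugator, List.append_assoc, hs]

/-- The word `τ_{n+1}(b)` ends with `b a_{n,0}`. With `p` the conjugator, `p τ(b) τ(a_{n,0}) = w_n
1^b w_n 1^{a_{n,0}} p` for `τ = τ_{[0,n+1)}`; since `p` is a prefix of the first `w_n`, cancelling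
it leaves the second one intact. -/
theorem word_infix_comp (n b : ℕ) : W.word n <:+: W.directive.comp 0 (n + 2) b := by
  obtain ⟨s, hs⟩ := W.conjugator_prefix n
  have h := List.flatMap_append_of_conj (W.word_append_conjugator n) [b, W.spacer n 0]
  have h2 : [b, W.spacer n 0].flatMap (W.directive.comp 0 (n + 1)) = s ++ List.replicate b 1 ++
      (W.word n ++ (List.replicate (W.spacer n 0) 1 ++ W.conjugator n)) := by
    refine List.append_cancel_left (as := W.conjugator n) ?_
    rw [← h]
    simp only [List.flatMap_cons, List.flatMap_nil, List.append_assoc, List.append_nil]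
    rw [← List.append_assoc (W.conjugator n) s, hs]
  rw [comp_succ_succ, List.flatMap_append, h2]
  exact ⟨_ ++ (s ++ List.replicate b 1), _, by simp only [List.append_assoc]; rfl⟩

/-- The words `w_n` and the images of letters under `τ_{[0,n)}` occur in one another. In one
direction, `w_k 1^a w_k` with `a = a_{N,i}`, `N ≥ k`, occurs in `w_{N+1}` because `w_k` is both a
prefix and a suffix of `w_N`. -/
theorem levelSubshift_zero : W.directive.levelSubshift 0 = W.subshift := by
  ext x
  constructor
  · rintro ⟨-, hx⟩ u hu
    obtain ⟨k, hk, a, ha, hua⟩ := hx hu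
    obtain ⟨k, rfl⟩ : ∃ k', k = k' + 1 := ⟨k - 1, by omega⟩
    rw [zero_add] at ha
    obtain ⟨N, hN, i, hi, rfl⟩ := ha
    refine ⟨N + 1, hua.trans ((comp_infix _ _).trans
      (List.IsInfix.trans ?_ (replicate_append_word_infix hi)))⟩
    obtain ⟨s, hs⟩ := W.word_suffix_word hN
    obtain ⟨t, ht⟩ := W.word_prefix_word hN
    refine ⟨s, t, ?_⟩
    calc s ++ (W.word k ++ List.replicate (W.spacer N i) 1 ++ W.word k) ++ t
        = (s ++ W.word k) ++ List.replicate (W.spacer N i) 1 ++ (W.word k ++ t) := by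
          simp only [List.append_assoc]
      _ = _ := by rw [hs, ht]
  · intro hx
    refine ⟨fun i => ?_, fun u hu => ?_⟩
    · obtain ⟨n, hn⟩ := hx [x i] ⟨i, 1, (window_one x i).symm⟩
      exact mem_word (hn.subset (List.mem_singleton_self _))
    · obtain ⟨n, hn⟩ := hx u hu
      refine ⟨n + 2, by omega, W.spacer (n + 1) 0, ?_, hn.trans (word_infix_comp n _)⟩
      rw [zero_add]
      exact ⟨n + 1, le_rfl, 0, by have := W.standard (n + 1); omega, rfl⟩

theorem not_periodic_of_mem_levelSubshift (hap : IsAperiodic W.subshift) {m : ℕ} {y : ℤ → ℕ}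
    (hy : y ∈ W.directive.levelSubshift m) {p : ℕ} (hp : 0 < p) : Symbolic.translate p y ≠ y := by
  intro h
  obtain ⟨p', hp', h'⟩ := translate_extend_eq_self_of_periodic
    (DirectiveSequence.comp_zero_ne_nil hy) hp h
  refine hap _ ?_ p' hp' h'
  rw [← levelSubshift_zero]
  exact DirectiveSequence.extend_comp_mem_levelSubshift hy

/-! ### Recognizability of the morphisms `τ_n`. -/

theorem recognizableOn_map_zero :
    RecognizableOn (W.directive.map 0) (W.directive.levelSubshift 1) := by
  refine recognizableOn_of_letter (fun j z => DirectiveSequence.translate_mem_levelSubshift j)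
    (fun z hz => DirectiveSequence.map_ne_nil_of_mem hz) ?_
  have hmap : ∀ b, W.directive.map 0 b = 0 :: List.replicate b 1 := fun b => rfl
  have key : ∀ z : ℤ → ℕ, (∀ i, extend (W.directive.map 0) z (cut (W.directive.map 0) z i) = 0) ∧
      ∀ i (r : ℕ), r < z i → extend (W.directive.map 0) z
        (cut (W.directive.map 0) z i + (r + 1 : ℕ)) = 1 := by
    intro z
    have hne : ∀ i, W.directive.map 0 (z i) ≠ [] := fun i => by simp [hmap]
    constructor
    · intro i
      have := extend_cut_add hne i 0 (by simp [hmap])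
      simpa [hmap] using this
    · intro i r hr
      have := extend_cut_add hne i (r + 1) (by simpa [hmap] using hr)
      rw [this]
      simp [hmap]
  have hcut : ∀ z : ℤ → ℕ, cut (W.directive.map 0) z 1 = z 0 + 1 := by
    intro z
    have := cut_add_one (W.directive.map 0) z 0
    simpa [hmap] using this
  have hone : ∀ z : ℤ → ℕ, ∀ t : ℤ, 0 < t → t ≤ z 0 → extend (W.directive.map 0) z t = 1 := by
    intro z t ht ht'
    obtain ⟨r, rfl⟩ : ∃ r : ℕ, t = (r + 1 : ℕ) := ⟨(t - 1).toNat, by omega⟩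
    have := (key z).2 0 r (by omega)
    simpa using this
  have hz0 : ∀ z : ℤ → ℕ, extend (W.directive.map 0) z 0 = 0 := fun z => by
    simpa using (key z).1 0
  have hz1 : ∀ z : ℤ → ℕ, extend (W.directive.map 0) z (z 0 + 1) = 0 := fun z => by
    rw [← hcut]; exact (key z).1 1
  -- The symbol `0` occurs only at cuts: with `k' < k`, a `0` at a cut of one image would face a `1`
  -- inside a block of the other.
  have hle : ∀ z z' : ℤ → ℕ, ∀ k k' : ℕ, k < (W.directive.map 0 (z 0)).length →
      k' < (W.directive.map 0 (z' 0)).length →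
      Symbolic.translate k (extend (W.directive.map 0) z) =
        Symbolic.translate k' (extend (W.directive.map 0) z') → k ≤ k' := by
    intro z z' k k' hk hk' h
    by_contra! hlt
    simp only [hmap, List.length_cons, List.length_replicate] at hk hk'
    have h1 := congrFun h (-(k' : ℤ))
    simp only [Symbolic.translate] at h1
    rw [neg_add_cancel, hz0, hone z _ (by omega) (by omega)] at h1
    exact one_ne_zero h1
  have hle2 : ∀ z z' : ℤ → ℕ, extend (W.directive.map 0) z = extend (W.directive.map 0) z' →
      z 0 ≤ z' 0 := by
    intro z z' h
    by_contra! hlt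
    have h1 := congrFun h (z' 0 + 1)
    rw [hz1, hone z _ (by omega) (by omega)] at h1
    exact one_ne_zero h1
  intro z _ z' _ k k' hk hk' h
  obtain rfl := le_antisymm (hle z z' k k' hk hk' h) (hle z' z k' k hk' hk h.symm)
  have h' := translate_injective _ h
  exact ⟨rfl, le_antisymm (hle2 z z' h') (hle2 z' z h'.symm)⟩

theorem cut_of_length_eq {α β : Type*} {σ : α → List β} {L : ℕ} (h : ∀ b, (σ b).length = L)
    (y : ℤ → α) (i : ℤ) : cut σ y i = L * i := by
  induction i using Int.induction_on with
  | zero => simp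
  | succ i ih => rw [cut_add_one, ih, h]; ring
  | pred i ih =>
    have := cut_add_one σ y (-(i : ℤ) - 1)
    rw [sub_add_cancel, ih, h] at this
    linarith

/-- If the images of the letters have the same length and differ in one place only, where the
letter itself stands, then points without period can be desubstituted in one way only. -/
theorem recognizableOn_of_hole {σ : ℕ → List ℕ} {L h : ℕ} {s : ℕ → ℕ} (hh : h < L)
    (hlen : ∀ b, (σ b).length = L) (hhole : ∀ b (hb : h < (σ b).length), (σ b)[h] = b)
    (hs : ∀ b r (hr : r < (σ b).length), r ≠ h → (σ b)[r] = s r) {Y : Set (ℤ → ℕ)}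
    (hY : ∀ j, ∀ z ∈ Y, Symbolic.translate j z ∈ Y)
    (hper : ∀ z ∈ Y, Symbolic.translate L (extend σ z) ≠ extend σ z) : RecognizableOn σ Y := by
  have hne : ∀ b, σ b ≠ [] := fun b hb => by
    have := hlen b
    rw [hb] at this
    simp at this
    omega
  refine recognizableOn_of_letter hY (fun z _ i => hne _) ?_
  -- Away from the holes, the image has period `L`.
  have hval : ∀ z : ℤ → ℕ, ∀ t : ℤ, (t - h) % L ≠ 0 →
      extend σ z (t + L) = extend σ z t := by
    intro z t ht
    obtain ⟨r, hr⟩ := Int.eq_ofNat_of_zero_le (Int.emod_nonneg t (show (L : ℤ) ≠ 0 by omega))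
    have hrL : r < L := by
      have := Int.emod_lt_of_pos t (show (0 : ℤ) < L by omega)
      omega
    have hrh : r ≠ h := by
      rintro rfl
      apply ht
      rw [← hr, Int.sub_emod, Int.emod_emod, sub_self, Int.zero_emod]
    have hdiv := Int.mul_ediv_add_emod t L
    have e : ∀ i : ℤ, extend σ z (L * i + r) = s r := by
      intro i
      rw [← cut_of_length_eq hlen z, extend_cut_add (fun i => hne _) i r (by rw [hlen]; exact hrL)]
      exact hs _ _ _ hrh
    have h1 := e (t / L)
    have h2 := e (t / L + 1)
    rw [show (L : ℤ) * (t / L) + r = t by omega] at h1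
    rw [mul_add, mul_one, add_right_comm, show (L : ℤ) * (t / L) + r = t by omega] at h2
    rw [h1, h2]
  intro z hz z' hz' k k' hk hk' he
  rw [hlen] at hk hk'
  -- If the phases differ, no position is a hole for both, as `0 < |k - k'| < L`. Each position then
  -- repeats after `L` steps by one of the two descriptions, so the point has period `L`.
  have hkk : k = k' := by
    by_contra hne
    refine hper z hz (translate_injective k ?_)
    funext t
    by_cases h1 : (t + k - h) % L = 0
    · have h2 : (t + k' - h) % L ≠ 0 := by
        intro h2
        have h3 := Int.dvd_sub (Int.dvd_of_emod_eq_zero h1) (Int.dvd_of_emod_eq_zero h2)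
        rw [show t + k - h - (t + k' - h) = (k - k' : ℤ) by ring] at h3
        have := Int.eq_zero_of_abs_lt_dvd h3 (by rw [abs_lt]; omega)
        omega
      have h3 := hval z' _ h2
      have e1 := congrFun he t
      have e2 := congrFun he (t + L)
      simp only [Symbolic.translate] at e1 e2 ⊢
      rw [e1, ← h3, add_right_comm t (k : ℤ), e2, add_right_comm]
    · have h3 := hval z _ h1
      simp only [Symbolic.translate]
      rw [← h3]
  subst hkk
  refine ⟨rfl, ?_⟩
  have h0 : ∀ z : ℤ → ℕ, extend σ z h = z 0 := by
    intro z
    have := extend_cut_add (σ := σ) (y := z) (fun i => hne _) 0 h (by rw [hlen]; exact hh)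
    rw [cut_zero, zero_add] at this
    rw [this, hhole]
  rw [← h0 z, ← h0 z', translate_injective _ he]

theorem recognizableOn_map (hap : IsAperiodic W.subshift) (m : ℕ) :
    RecognizableOn (W.directive.map m) (W.directive.levelSubshift (m + 1)) := by
  rcases m with - | n
  · exact recognizableOn_map_zero
  have hq := W.standard n
  have hmap : W.directive.map (n + 1) = W.morphism (n + 1) := rfl
  refine recognizableOn_of_hole (L := W.q n + 1) (h := W.q n - 1)
    (s := fun r => if r < W.q n - 1 then W.spacer n (r + 1) else W.spacer n 0) (by omega) ?_ ?_ ?_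
    (fun j z => DirectiveSequence.translate_mem_levelSubshift j) ?_
  · intro b
    simp [hmap, morphism_succ_eq]
    omega
  · intro b hb
    simp [hmap, morphism_succ_eq]
  · intro b r hr hrh
    simp only [hmap, morphism_succ_eq] at hr ⊢
    simp at hr
    split_ifs with h1
    · rw [List.getElem_append_left (by simpa using h1)]
      simp
    · obtain rfl : r = W.q n := by omega
      rw [List.getElem_append_right (by simp)]
      simp [show W.q n - (W.q n - 1) = 1 by omega]
  · intro z hz
    exact not_periodic_of_mem_levelSubshift hap
      (DirectiveSequence.extend_map_mem_levelSubshift hz) (by omega)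

theorem recognizableOn_comp (hap : IsAperiodic W.subshift) (m : ℕ) :
    RecognizableOn (W.directive.comp 0 m) (W.directive.levelSubshift m) :=
  DirectiveSequence.recognizableOn_comp (recognizableOn_map hap) m

/-! ### Letter counts and heights. -/

theorem count_map (n a b : ℕ) :
    (W.directive.map (n + 1) b).count a = W.f (n + 1) a + if b = a then 1 else 0 := by
  have hq : W.q n = W.q n - 1 + 1 := by have := W.standard n; omega
  have hf : W.f (n + 1) a = ((List.range (W.q n)).map (W.spacer n)).count a := by
    rw [f, List.count_eq_countP, List.countP_map, List.countP_eq_length_filter]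
    rw [Finset.card_def, Finset.filter_val, Finset.range_val, Multiset.range, Multiset.filter_coe,
      Multiset.coe_card]
    congr 1
  rw [hf, hq, List.range_succ_eq_map]
  change (W.morphism (n + 1) b).count a = _
  rw [morphism_succ_eq]
  simp [List.count_append, List.count_cons, Function.comp_def]
  ring

/-- The letter `b` enters `τ_n(b)` once as a variable and all the other letters are fixed, so the
difference `b` between heights is passed on unchanged from level to level. -/
theorem exists_height (n : ℕ) :
    ∃ H, 0 < H ∧ ∀ b, W.directive.height (n + 1) b = H + b := by
  induction n with
  | zero =>
    refine ⟨1, one_pos, fun b => ?_⟩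
    simp [DirectiveSequence.height, DirectiveSequence.comp, directive, morphism, add_comm]
  | succ n ih =>
    obtain ⟨H, hH, h⟩ := ih
    simp only [DirectiveSequence.height] at h ⊢
    refine ⟨((((List.range (W.q n - 1)).map fun i => W.spacer n (i + 1)).flatMap
      (W.directive.comp 0 (n + 1))).length + H + (H + W.spacer n 0)), by omega, fun b => ?_⟩
    rw [comp_succ_succ, List.flatMap_append, List.length_append]
    simp only [List.flatMap_cons, List.flatMap_nil, List.length_append, List.append_nil, h]
    ring

end FerencziParameters

theorem ENNReal.zero_lt_liminf_iff {ι : Type*} {l : Filter ι} {g : ι → ℝ≥0∞} :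
    0 < liminf g l ↔ ∃ c, 0 < c ∧ ∀ᶠ i in l, c ≤ g i := by
  constructor
  · intro h
    obtain ⟨c, hc, hc'⟩ := exists_between h
    exact ⟨c, hc, (eventually_lt_of_lt_liminf hc').mono fun _ => le_of_lt⟩
  · rintro ⟨c, hc, h⟩
    exact hc.trans_le (le_liminf_of_le (by isBoundedDefault) h)

/-! ### Base measures as frequency sums. -/

namespace FerencziParameters

open Symbolic

variable {W : FerencziParameters} {μ : Measure (ℤ → ℕ)}

/-- The measure of the union of the bases of level `m`. -/
noncomputable def baseMass (W : FerencziParameters) (μ : Measure (ℤ → ℕ)) (m : ℕ) : ℝ≥0∞ :=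
  ∑' a, μ (W.directive.base m a)

theorem tsum_f (n : ℕ) : ∑' a, (W.f (n + 1) a : ℝ≥0∞) = W.q n := by
  have : ∀ a, (W.f (n + 1) a : ℝ≥0∞) =
      ∑ i ∈ Finset.range (W.q n), if a = W.spacer n i then 1 else 0 := by
    intro a
    rw [f, Finset.card_filter]
    push_cast
    simp only [eq_comm]
  simp_rw [this]
  rw [Summable.tsum_finsetSum fun _ _ => ENNReal.summable]
  simp [tsum_ite_eq]

/-- The part `f` of the letter count is independent of the tower and multiplies the whole base mass;
the additional letter contributes only from the tower over `a` itself. -/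
theorem measure_base_succ (hap : IsAperiodic W.subshift) (hinv : MeasurePreserving shift μ μ)
    (n a : ℕ) : μ (W.directive.base (n + 1) a) =
      W.f (n + 1) a * W.baseMass μ (n + 2) + μ (W.directive.base (n + 2) a) := by
  rw [DirectiveSequence.measure_base (alphabet_finite hap) (recognizableOn_comp hap (n + 1 + 1))
    hinv]
  simp_rw [count_map, Nat.cast_add, add_mul]
  rw [ENNReal.tsum_add, ENNReal.tsum_mul_left, baseMass]
  congr 1
  rw [tsum_eq_single a fun c hc => by simp [hc]]
  simp

theorem baseMass_succ (hap : IsAperiodic W.subshift) (hinv : MeasurePreserving shift μ μ) (n : ℕ) :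
    W.baseMass μ (n + 1) = (W.q n + 1 : ℕ) * W.baseMass μ (n + 2) := by
  conv_lhs => rw [baseMass]
  rw [tsum_congr (measure_base_succ hap hinv n), ENNReal.tsum_add, ENNReal.tsum_mul_right,
    tsum_f, ← baseMass]
  push_cast
  ring

theorem baseMass_eq_Q_mul (hap : IsAperiodic W.subshift) (hinv : MeasurePreserving shift μ μ)
    (n j : ℕ) : W.baseMass μ (n + 1) = W.Q n (n + 1 + j) * W.baseMass μ (n + 2 + j) := by
  induction j with
  | zero => rw [baseMass_succ hap hinv]; simp [Q]
  | succ j ih =>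
    have hQ : W.Q n (n + 1 + (j + 1)) = W.Q n (n + 1 + j) * (W.q (n + 1 + j) + 1) := by
      rw [Q, ← add_assoc, Finset.prod_Ico_succ_top (by omega), ← Q]
    rw [ih, hQ, show n + 2 + j = n + 1 + j + 1 by ring, baseMass_succ hap hinv,
      show n + 2 + (j + 1) = n + 1 + j + 2 by ring, Nat.cast_mul, mul_assoc]

theorem measure_base_eq_sum_add (hap : IsAperiodic W.subshift)
    (hinv : MeasurePreserving shift μ μ) (n a N : ℕ) : μ (W.directive.base (n + 1) a) =
      ∑ j ∈ Finset.range N, W.f (n + 1 + j) a * W.baseMass μ (n + 2 + j) +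
        μ (W.directive.base (n + 1 + N) a) := by
  induction N with
  | zero => simp
  | succ N ih =>
    rw [ih, Finset.sum_range_succ, show n + 1 + N = n + N + 1 by ring,
      measure_base_succ hap hinv, ← add_assoc, show n + N + 2 = n + 2 + N by ring,
      show n + 1 + (N + 1) = n + 2 + N by ring]

theorem baseMass_le_pow (hap : IsAperiodic W.subshift) (hinv : MeasurePreserving shift μ μ)
    (n N : ℕ) : W.baseMass μ (n + 1 + N) ≤ 2⁻¹ ^ N * W.baseMass μ (n + 1) := by
  induction N with
  | zero => simp
  | succ N ih =>
    have h1 : 2 * W.baseMass μ (n + 1 + (N + 1)) ≤ W.baseMass μ (n + 1 + N) := by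
      rw [show n + 1 + N = n + N + 1 by ring, baseMass_succ hap hinv,
        show n + 1 + (N + 1) = n + N + 2 by ring]
      have := W.standard (n + N)
      gcongr
      exact_mod_cast (show 2 ≤ W.q (n + N) + 1 by omega)
    rw [pow_succ', mul_assoc]
    refine le_trans ?_ (mul_le_mul_right (h1.trans ih) _)
    rw [← mul_assoc, ENNReal.inv_mul_cancel (by simp) (by simp), one_mul]

/-- The recursion telescopes, and its remainder vanishes because base masses at least halve at each
level. Finiteness of the mass is needed for this limit. -/
theorem measure_base_eq_baseMass_mul (hap : IsAperiodic W.subshift)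
    (hinv : MeasurePreserving shift μ μ) (n a : ℕ) (hfin : W.baseMass μ (n + 1) ≠ ∞) :
    μ (W.directive.base (n + 1) a) = W.baseMass μ (n + 1) * W.frequencySum (n + 1) a := by
  have hrest : Tendsto (fun N => μ (W.directive.base (n + 1 + N) a)) atTop (nhds 0) := by
    have h0 : Tendsto (fun N : ℕ => (2⁻¹ : ℝ≥0∞) ^ N * W.baseMass μ (n + 1)) atTop (nhds 0) := by
      have := ENNReal.Tendsto.mul_const (b := W.baseMass μ (n + 1))
        (ENNReal.tendsto_pow_atTop_nhds_zero_of_lt_one (r := 2⁻¹) (by simp)) (Or.inr hfin)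
      rwa [zero_mul] at this
    exact tendsto_of_tendsto_of_tendsto_of_le_of_le tendsto_const_nhds h0 (fun _ => zero_le)
      fun N => (ENNReal.le_tsum a).trans (baseMass_le_pow hap hinv n N)
  have hsum := (ENNReal.tendsto_nat_tsum
    fun j => (W.f (n + 1 + j) a : ℝ≥0∞) * W.baseMass μ (n + 2 + j)).add hrest
  simp_rw [← measure_base_eq_sum_add hap hinv] at hsum
  rw [tendsto_nhds_unique tendsto_const_nhds hsum, add_zero, frequencySum, ← ENNReal.tsum_mul_left]
  refine tsum_congr fun j => ?_
  have hQ : (W.Q n (n + 1 + j) : ℝ≥0∞) ≠ 0 := by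
    exact_mod_cast (Finset.prod_pos fun i _ => Nat.succ_pos _).ne'
  rw [Nat.add_sub_cancel, baseMass_eq_Q_mul hap hinv n j, mul_right_comm,
    ENNReal.mul_div_cancel hQ (ENNReal.natCast_ne_top _)]

/-- The measure of the tower of a letter and its frequency differ by a bounded factor. -/
theorem measure_tower_le_and_le (hap : IsAperiodic W.subshift) [IsProbabilityMeasure μ]
    (hX : μ W.subshift = 1) (hinv : MeasurePreserving shift μ μ) {M : ℕ}
    (hM : ∀ n, ∀ i < W.q n, W.spacer n i ≤ M) (n : ℕ) {a : ℕ} (ha : a ≤ M) :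
    μ (W.directive.tower (n + 1) a) ≤ (M + 1 : ℕ) * W.frequencySum (n + 1) a ∧
      W.frequencySum (n + 1) a ≤ (M + 1 : ℕ) * μ (W.directive.tower (n + 1) a) := by
  obtain ⟨H, hH, hh⟩ := W.exists_height n
  have hsum := DirectiveSequence.tsum_height_mul_measure_base (alphabet_finite hap)
    (recognizableOn_comp hap (n + 1)) hinv (by rw [levelSubshift_zero, hX])
  simp_rw [hh] at hsum
  have hupper : (H : ℝ≥0∞) * W.baseMass μ (n + 1) ≤ 1 := by
    rw [← hsum, baseMass, ← ENNReal.tsum_mul_left]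
    exact ENNReal.tsum_le_tsum fun b => by gcongr; exact Nat.le_add_right _ _
  have hHM : ∀ b ≤ M, H + b ≤ (M + 1) * H := fun b hb => by nlinarith
  -- Letters outside the alphabet may exceed `M`, but their bases are empty.
  have hlower : 1 ≤ ((M + 1 : ℕ) : ℝ≥0∞) * (H * W.baseMass μ (n + 1)) := by
    rw [← hsum, baseMass, ← ENNReal.tsum_mul_left, ← ENNReal.tsum_mul_left]
    refine ENNReal.tsum_le_tsum fun b => ?_
    by_cases hb : b ∈ W.directive.alphabet (n + 1)
    · obtain ⟨N, -, i, hi, rfl⟩ := hb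
      rw [← mul_assoc]
      gcongr
      exact_mod_cast hHM _ (hM N i hi)
    · simp [DirectiveSequence.base_eq_empty hb]
  have hfin : W.baseMass μ (n + 1) ≠ ∞ := by
    intro h
    rw [h, ENNReal.mul_top (by exact_mod_cast hH.ne')] at hupper
    simp at hupper
  rw [DirectiveSequence.measure_tower (alphabet_finite hap) (recognizableOn_comp hap (n + 1)) hinv,
    measure_base_eq_baseMass_mul hap hinv n a hfin, hh]
  set F := W.frequencySum (n + 1) a
  set E := W.baseMass μ (n + 1)
  constructor
  · calc ((H + a : ℕ) : ℝ≥0∞) * (E * F) ≤ ((M + 1) * H : ℕ) * (E * F) := by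
          gcongr; exact hHM a ha
      _ = (M + 1 : ℕ) * ((H * E) * F) := by push_cast; ring
      _ ≤ (M + 1 : ℕ) * (1 * F) := by gcongr
      _ = _ := by rw [one_mul]
  · calc F = 1 * F := (one_mul F).symm
      _ ≤ (((M + 1 : ℕ) : ℝ≥0∞) * (H * E)) * F := by gcongr
      _ = (M + 1 : ℕ) * (H * (E * F)) := by ring
      _ ≤ (M + 1 : ℕ) * ((H + a : ℕ) * (E * F)) := by gcongr; exact Nat.le_add_right _ _

/-! ### Eventual alphabet and exact finite rank. -/

theorem mem_eventualAlphabet_of_forall {a : ℕ} (h : ∀ n, a ∈ W.directive.alphabet (n + 1)) :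
    a ∈ W.directive.eventualAlphabet := by
  filter_upwards [eventually_ge_atTop 1] with n hn
  obtain ⟨n, rfl⟩ := Nat.exists_eq_add_of_le' hn
  exact h n

theorem alphabet_succ_antitone {n N : ℕ} (h : n ≤ N) :
    W.directive.alphabet (N + 1) ⊆ W.directive.alphabet (n + 1) := by
  rintro a ⟨K, hK, hi⟩
  exact ⟨K, h.trans hK, hi⟩

/-- From level `1` on the alphabets are finite and decreasing, so each of the finitely many letters
that disappears has done so by a common level. -/
theorem eventually_alphabet_eq (hap : IsAperiodic W.subshift) :
    ∀ᶠ n in atTop, W.directive.alphabet n = W.directive.eventualAlphabet := by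
  obtain ⟨n₀, hn₀⟩ : ∃ n₀, ∀ n ≥ n₀, ∀ a ∈ W.directive.alphabet 1,
      a ∈ W.directive.alphabet (n + 1) → a ∈ W.directive.eventualAlphabet := by
    rw [← eventually_atTop, (alphabet_finite hap 1).eventually_all]
    intro a _
    by_cases h : ∀ n, a ∈ W.directive.alphabet (n + 1)
    · exact Eventually.of_forall fun n _ => mem_eventualAlphabet_of_forall h
    · push Not at h
      obtain ⟨n, hn⟩ := h
      filter_upwards [eventually_ge_atTop n] with N hN hmem
      exact absurd (alphabet_succ_antitone hN hmem) hn
  filter_upwards [eventually_ge_atTop (n₀ + 1)] with n hn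
  obtain ⟨n, rfl⟩ := Nat.exists_eq_add_of_le' (show 1 ≤ n by omega)
  refine Set.Subset.antisymm
    (fun a ha => hn₀ n (by omega) a (alphabet_succ_antitone (Nat.zero_le n) ha) ha) fun a ha => ?_
  obtain ⟨N, hmem, hN⟩ := (ha.and (eventually_ge_atTop (n + 1))).exists
  obtain ⟨N, rfl⟩ := Nat.exists_eq_add_of_le' (show 1 ≤ N by omega)
  exact alphabet_succ_antitone (by omega) hmem

theorem exactFiniteRank_iff (hap : IsAperiodic W.subshift) :
    W.directive.ExactFiniteRank μ ↔ ∀ a ∈ W.directive.eventualAlphabet,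
      0 < liminf (fun m => μ (W.directive.tower m a)) atTop := by
  constructor
  · rintro ⟨n₀, -, -, ⟨c, hc, h⟩, -⟩ a ha
    exact ENNReal.zero_lt_liminf_iff.2
      ⟨c, hc, (eventually_ge_atTop n₀).mono fun n hn => h n hn a ha⟩
  · intro h
    have hev := eventually_alphabet_eq hap
    have hfin : W.directive.eventualAlphabet.Finite := by
      obtain ⟨n, hn⟩ := hev.exists
      exact hn ▸ alphabet_finite hap n
    choose! c hc hc' using fun a ha => ENNReal.zero_lt_liminf_iff.1 (h a ha)
    obtain ⟨n₀, hn₀⟩ := eventually_atTop.1 (hev.and (hfin.eventually_all.2 hc'))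
    -- The common constant is the least of the finitely many lower bounds. The clause on vanishing
    -- towers is vacuous, since no letter is left outside the eventual alphabet.
    refine ⟨n₀, fun n hn => (hn₀ n hn).1.trans (hn₀ n₀ le_rfl).1.symm, (hn₀ n₀ le_rfl).1.ge,
      ⟨hfin.toFinset.inf c, ?_, fun n hn a ha => ?_⟩, fun a ha => ?_⟩
    · rw [Finset.lt_inf_iff (by simp)]
      exact fun a ha => hc a (hfin.mem_toFinset.1 ha)
    · exact (Finset.inf_le (hfin.mem_toFinset.2 ha)).trans ((hn₀ n hn).2 a ha)
    · exact absurd ((hn₀ n₀ le_rfl).1 ▸ ha.1) ha.2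

theorem zero_lt_liminf_measure_tower_iff (hap : IsAperiodic W.subshift) [IsProbabilityMeasure μ]
    (hX : μ W.subshift = 1) (hinv : MeasurePreserving shift μ μ) {a : ℕ}
    (ha : a ∈ W.directive.eventualAlphabet) :
    0 < liminf (fun m => μ (W.directive.tower m a)) atTop ↔
      0 < liminf (fun m => W.frequencySum m a) atTop := by
  obtain ⟨M, hM⟩ := exists_spacer_le hap
  have haM : a ≤ M := by
    obtain ⟨n, hmem, hn⟩ := (ha.and (eventually_ge_atTop 1)).exists
    obtain ⟨n, rfl⟩ := Nat.exists_eq_add_of_le' hn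
    obtain ⟨N, -, i, hi, rfl⟩ := hmem
    exact hM N i hi
  have key : ∀ g g' : ℕ → ℝ≥0∞, (∀ n, g (n + 1) ≤ (M + 1 : ℕ) * g' (n + 1)) →
      0 < liminf g atTop → 0 < liminf g' atTop := by
    intro g g' hgg h
    obtain ⟨c, hc, hc'⟩ := ENNReal.zero_lt_liminf_iff.1 h
    refine ENNReal.zero_lt_liminf_iff.2
      ⟨c / (M + 1 : ℕ), ENNReal.div_pos hc.ne' (ENNReal.natCast_ne_top _), ?_⟩
    filter_upwards [hc', eventually_ge_atTop 1] with n hn hn1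
    obtain ⟨n, rfl⟩ := Nat.exists_eq_add_of_le' hn1
    exact ENNReal.div_le_of_le_mul' (hn.trans (hgg n))
  exact ⟨key _ _ fun n => (measure_tower_le_and_le hap hX hinv hM n haM).1,
    key _ _ fun n => (measure_tower_le_and_le hap hX hinv hM n haM).2⟩

end FerencziParameters

theorem mainTheorem12 (W : FerencziParameters)
    (hmin : Symbolic.IsMinimal W.subshift) (hap : Symbolic.IsAperiodic W.subshift)
    (μ : Measure (ℤ → ℕ)) [IsProbabilityMeasure μ] (hX : μ W.subshift = 1)
    (hinv : MeasurePreserving Symbolic.shift μ μ) :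
    (∀ a ∈ W.directive.eventualAlphabet,
      (0 < liminf (fun m => μ (W.directive.tower m a)) atTop ↔
        0 < liminf (fun m => W.frequencySum m a) atTop)) ∧
    (W.directive.ExactFiniteRank μ ↔
      ∀ a ∈ W.directive.eventualAlphabet,
        0 < liminf (fun m => W.frequencySum m a) atTop) := by
  have h := fun a (ha : a ∈ W.directive.eventualAlphabet) =>
    FerencziParameters.zero_lt_liminf_measure_tower_iff hap hX hinv ha
  exact ⟨h, (FerencziParameters.exactFiniteRank_iff hap).trans (forall₂_congr h)⟩
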